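/- Let $0<a\le 1$ and $0<\alpha<1$, and let $\mathcal E$ be the real elliptic curve $$y^2=x^2+\frac{4x(x-a^2)(x-a^{-2})}{(a+1/a)^2(\alpha+1/\alpha)^2},$$ with its group law (the point at infinity is the identity). Suppose that $(a^{-2},a^{-2})\in\mathcal E$ is a torsion point of order $d$. Put $\sigma(x,y)=(x,y)+(a^{-2},a^{-2})$, $(x_0,y_0)=\left(-1,-\tfrac{1-\alpha^2}{1+\alpha^2}\right)$ and, for points of $\mathcal E$ with $x<0$, $$a(x,y)=\frac{a(a^2+1)(\alpha^2+1)}2\,\frac{y-x}{1-a^2x},\qquad b(x,y)=-\frac1{\alpha a x},\qquad d(x,y)=\frac{2a\alpha x(x-a^{-2})}{(a^2+1)(\alpha+1/\alpha)(y-x)} .$$ Let $P_-^{(d)}(z)=\mathcal P_-(\sigma^0(x_0,y_0))\cdots\mathcal P_-(\sigma^{d-1}(x_0,y_0))$ and $P_+^{(d)}(z)=\mathcal P_+(\sigma^{d-1}(x_0,y_0))\cdots\mathcal P_+(\sigma^{0}(x_0,y_0))$, where $$\mathcal P_-(x,y)=b(x,y)\begin{pmatrix}a(x,y)&0\\0&1\end{pmatrix}\begin{pmatrix}1&1\\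 a^2/z&1\end{pmatrix}\begin{pmatrix}1&0\\0&a(x,y)\end{pmatrix},\qquad \mathcal P_+(x,y)=\begin{pmatrix}1&0\\0&\frac{a^2}{\alpha^2}d(x,y)\end{pmatrix}\begin{pmatrix}1&a^2z\\1&1\end{pmatrix}\begin{pmatrix}1&0\\0&d(x,y)\end{pmatrix}.$$ Let $$R(z)=(\alpha+1/\alpha)^2(1+a^2)^2-4(1-a^2z)(1-a^2/z),$$ let $\mathcal R$ be the compact Riemann surface of $w^2=R(z)$, and let $R(z)^{1/2}$ denote the meromorphic function $w$ on $\mathcal R$; the first sheet is the one on which $R(z)^{1/2}>0$ for $z>0$. Put $\lambda=\frac12(\alpha+1/\alpha)(1+a^2)+\frac12R(z)^{1/2}$ and $e=\left(a\alpha(1+z),\ \lambda-\alpha(a^2+1)\right)^{T}$. There are functions $\mu$ and $\nu$ on $\mathcal R\setminus\{0,\infty\}$, continuous there, with $P_-^{(d)}(z)e=\mu e$ and $P_+^{(d)}(z)e=\nu e$ (and they are unique). For real $\tau,\xi$ let $\Phi$ be the multivalued function on $\mathcal R$ $$\Phi=(1-\tau)\log\mu-\tau\log\nu+d(1-\tau+\xi)\log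 z-d(1-\tau)\log(z-a^2).$$ Then, near every point of $\mathcal R$ lying over a $z\in\mathbb C$ with $z\ne0$, $z\neq a^{\pm2}$ and $R(z)\ne0$, local branches of $\Phi$ exist, and the derivative of each of them with respect to the local coordinate $z$ is $$\Phi'(z)=d(1-\tau)a^2\,\frac{z\gamma_1+\gamma_2+\gamma_3R(z)^{1/2}}{(z-a^2)zR(z)^{1/2}}-d\tau\,\frac{\gamma_1+\gamma_2z+\gamma_3zR(z)^{1/2}}{(z-a^{-2})zR(z)^{1/2}}+\frac{d(1-\tau+\xi)}z-\frac{d(1-\tau)}{z-a^2},$$ where $\gamma_1,\gamma_2,\gamma_3$ are the real constants determined by $$\gamma_1=-\left(\frac1d\sum_{j=0}^{d-1}a(\sigma^j(x_0,y_0))\right)^{1/2}\left(\frac1d\sum_{k=0}^{d-1}\frac1{a(\sigma^k(x_0,y_0))}\right)^{1/2},\qquad \gamma_2+a^2\gamma_1=-\tfrac12(a^2+1)(\alpha+1/\alpha),\qquad \gamma_3=\tfrac12 .$$ -/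

import Mathlib

open scoped Matrix Topology

noncomputable section

namespace BiasedAztec

/-! ### The elliptic curve and the linear flow on it -/

/-- The scaling factor between the ordinate `y` on the curve
`y² = x² + 4 x (x - a²) (x - 1/a²) / ((a + 1/a)² (α + 1/α)²)`
and the ordinate `Y` of its Weierstrass form: `y = yScale a α * Y`. -/
def yScale (a α : ℝ) : ℝ := 2 / ((a + 1 / a) * (α + 1 / α))

/-- The Weierstrass form `Y² = X³ + a₂ X² + X` of the elliptic curve of the model,
obtained by `x = X` and `y = yScale a α * Y`. -/
def curve (a α : ℝ) : WeierstrassCurve.Affine ℝ where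
  a₁ := 0
  a₂ := (a + 1 / a) ^ 2 * (α + 1 / α) ^ 2 / 4 - a ^ 2 - 1 / a ^ 2
  a₃ := 0
  a₄ := 1
  a₆ := 0

theorem yScale_pos {a α : ℝ} (ha : 0 < a) (hα : 0 < α) : 0 < yScale a α := by
  unfold yScale; positivity

/-- In the coordinates `(x, y) = (X, yScale a α * Y)` the curve is the one of the model. -/
theorem curve_equation_iff {a α : ℝ} (ha : 0 < a) (hα : 0 < α) (x Y : ℝ) :
    (curve a α).Equation x Y ↔
      (yScale a α * Y) ^ 2 = x ^ 2 +
        4 * x * (x - a ^ 2) * (x - 1 / a ^ 2) / ((a + 1 / a) ^ 2 * (α + 1 / α) ^ 2) := by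
  have h1 : 0 < a + 1 / a := by positivity
  have h2 : 0 < α + 1 / α := by positivity
  rw [WeierstrassCurve.Affine.equation_iff]
  simp only [curve, yScale]
  have hk : (a + 1 / a) ≠ 0 := h1.ne'
  have hl : (α + 1 / α) ≠ 0 := h2.ne'
  generalize hA : a + 1 / a = A at *
  generalize hB : α + 1 / α = B at *
  have ha' : a ≠ 0 := ha.ne'
  have e : (2 / (A * B) * Y) ^ 2 - (x ^ 2 +
      4 * x * (x - a ^ 2) * (x - 1 / a ^ 2) / (A ^ 2 * B ^ 2)) =
      (4 / (A ^ 2 * B ^ 2)) * ((Y ^ 2 + 0 * x * Y + 0 * Y) -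
        (x ^ 3 + (A ^ 2 * B ^ 2 / 4 - a ^ 2 - 1 / a ^ 2) * x ^ 2 + 1 * x + 0)) := by
    field_simp
    ring
  have h4 : 4 / (A ^ 2 * B ^ 2) ≠ 0 := by positivity
  rw [← sub_eq_zero, ← sub_eq_zero (a := (2 / (A * B) * Y) ^ 2), e, mul_eq_zero]
  simp [h4]

theorem curve_nonsingular {a α : ℝ} (ha : 0 < a) (hα : 0 < α) {x y : ℝ} (hy : y ≠ 0)
    (h : y ^ 2 = x ^ 2 +
        4 * x * (x - a ^ 2) * (x - 1 / a ^ 2) / ((a + 1 / a) ^ 2 * (α + 1 / α) ^ 2)) :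
    (curve a α).Nonsingular x (y / yScale a α) := by
  have hk := yScale_pos ha hα
  rw [WeierstrassCurve.Affine.nonsingular_iff']
  refine ⟨?_, Or.inr ?_⟩
  · rw [curve_equation_iff ha hα, mul_div_cancel₀ _ hk.ne', h]
  · have : y / yScale a α ≠ 0 := div_ne_zero hy hk.ne'
    simpa [curve] using this

/-- The point `(x, y) = (a⁻², a⁻²)` of the elliptic curve. -/
def shiftPoint (a α : ℝ) (ha : 0 < a) (hα : 0 < α) : (curve a α).Point :=
  .some (1 / a ^ 2) ((1 / a ^ 2) / yScale a α)
    (curve_nonsingular ha hα (by positivity) (by simp))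

/-- The initial point `(x₀, y₀) = (-1, -(1 - α²) / (1 + α²))` of the flow. -/
def initialPoint (a α : ℝ) (ha : 0 < a) (hα : 0 < α) (hα1 : α < 1) : (curve a α).Point :=
  .some (-1) (-((1 - α ^ 2) / (1 + α ^ 2)) / yScale a α)
    (curve_nonsingular ha hα
      (by
        have : 0 < 1 - α ^ 2 := by nlinarith
        have : 0 < (1 - α ^ 2) / (1 + α ^ 2) := by positivity
        linarith)
      (by
        field_simp
        ring))

/-- The translation `σ(x, y) = (x, y) + (a⁻², a⁻²)`. -/
def sigma (a α : ℝ) (ha : 0 < a) (hα : 0 < α) (p : (curve a α).Point) : (curve a α).Point :=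
  p + shiftPoint a α ha hα

/-- The coordinates `(x, y)` on the curve of the model (not the Weierstrass coordinates) of a
point; the value at the point at infinity, which the flow never visits, is irrelevant. -/
def coords {a α : ℝ} : (curve a α).Point → ℝ × ℝ
  | .zero => (0, 0)
  | .some x y _ => (x, yScale a α * y)

/-- The coordinates of `σ^j (x₀, y₀)`. -/
def orbit (a α : ℝ) (ha : 0 < a) (hα : 0 < α) (hα1 : α < 1) (j : ℕ) : ℝ × ℝ :=
  coords ((sigma a α ha hα)^[j] (initialPoint a α ha hα hα1))

/-! ### The factors of the Wiener-Hopf factorization -/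

/-- The function `a(x, y)`. -/
def fnA (a α : ℝ) (p : ℝ × ℝ) : ℝ :=
  a * (a ^ 2 + 1) * (α ^ 2 + 1) / 2 * ((p.2 - p.1) / (1 - a ^ 2 * p.1))

/-- The function `b(x, y)`. -/
def fnB (a α : ℝ) (p : ℝ × ℝ) : ℝ := -(1 / (α * a * p.1))

/-- The function `d(x, y)`. -/
def fnD (a α : ℝ) (p : ℝ × ℝ) : ℝ :=
  2 * a * α * p.1 * (p.1 - 1 / a ^ 2) / ((a ^ 2 + 1) * (α + 1 / α) * (p.2 - p.1))

/-- The matrix `𝒫₋(x, y)`, as a function of `z`. -/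
def factorMinus (a α : ℝ) (p : ℝ × ℝ) (z : ℂ) : Matrix (Fin 2) (Fin 2) ℂ :=
  (fnB a α p : ℂ) •
    (!![(fnA a α p : ℂ), 0; 0, 1] * !![1, 1; (a : ℂ) ^ 2 / z, 1] * !![1, 0; 0, (fnA a α p : ℂ)])

/-- The matrix `𝒫₊(x, y)`, as a function of `z`. -/
def factorPlus (a α : ℝ) (p : ℝ × ℝ) (z : ℂ) : Matrix (Fin 2) (Fin 2) ℂ :=
  !![1, 0; 0, (a : ℂ) ^ 2 / (α : ℂ) ^ 2 * (fnD a α p : ℂ)] *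
    !![1, (a : ℂ) ^ 2 * z; 1, 1] * !![1, 0; 0, (fnD a α p : ℂ)]

/-- `P₋^{(d)}(z) = P_{0,-}(z) P_{1,-}(z) ⋯ P_{d-1,-}(z)` with `P_{j,-} = 𝒫₋(σ^j (x₀, y₀))`. -/
def Pminus (a α : ℝ) (ha : 0 < a) (hα : 0 < α) (hα1 : α < 1) (d : ℕ) (z : ℂ) :
    Matrix (Fin 2) (Fin 2) ℂ :=
  ((List.range d).map fun j => factorMinus a α (orbit a α ha hα hα1 j) z).prod

/-- `P₊^{(d)}(z) = P_{d-1,+}(z) ⋯ P_{1,+}(z) P_{0,+}(z)` with `P_{j,+} = 𝒫₊(σ^j (x₀, y₀))`. -/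
def Pplus (a α : ℝ) (ha : 0 < a) (hα : 0 < α) (hα1 : α < 1) (d : ℕ) (z : ℂ) :
    Matrix (Fin 2) (Fin 2) ℂ :=
  ((List.range d).map fun j => factorPlus a α (orbit a α ha hα hα1 j) z).reverse.prod

/-! ### The spectral surface -/

/-- The discriminant `R(z)` of the spectral curve of `P(z)`. -/
def discR (a α : ℝ) (z : ℂ) : ℂ :=
  ((α : ℂ) + 1 / (α : ℂ)) ^ 2 * (1 + (a : ℂ) ^ 2) ^ 2
    - 4 * (1 - (a : ℂ) ^ 2 * z) * (1 - (a : ℂ) ^ 2 / z)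

/-- The Riemann surface `ℛ` without its points `0` and `∞`, as the set of pairs `(z, w)` with
`w² = R(z)`; the function `R(z)^{1/2}` on `ℛ` is `(z, w) ↦ w`.  Since `R` takes values in
`(-∞, 0]` exactly on the two cuts, the first sheet (where `R(z)^{1/2} > 0` for `z > 0`) is the
part `Re w > 0`, the second sheet is the part `Re w < 0`, and `Re w = 0` over the cuts.
The branch points other than `0` and `∞` are the points with `w = 0`. -/
def surface (a α : ℝ) : Set (ℂ × ℂ) := {p | p.1 ≠ 0 ∧ p.2 ^ 2 = discR a α p.1}

/-- The eigenvalue `λ = ½ (α + 1/α) (1 + a²) + ½ R^{1/2}` of `P(z)`. -/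
def lam (a α : ℝ) (p : ℂ × ℂ) : ℂ :=
  1 / 2 * ((α : ℂ) + 1 / (α : ℂ)) * (1 + (a : ℂ) ^ 2) + 1 / 2 * p.2

/-- The eigenvector of `P(z)` for the eigenvalue `λ`: over a point `z` off the cuts, its values on
the two sheets are the two columns of the matrix `E(z)`. -/
def eigenvector (a α : ℝ) (p : ℂ × ℂ) : Fin 2 → ℂ :=
  ![(a : ℂ) * (α : ℂ) * (1 + p.1), lam a α p - (α : ℂ) * ((a : ℂ) ^ 2 + 1)]

/-- `m` is the eigenvalue of `M(z)`, as a function on the surface, that belongs to the common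
eigenvectors: `M(z) E(z) = E(z) diag (m(z⁽¹⁾), m(z⁽²⁾))`.  Continuity fixes the value at the only
point (over `z = -1`) where the chosen eigenvector vanishes. -/
structure IsSurfaceEigenvalue (a α : ℝ) (M : ℂ → Matrix (Fin 2) (Fin 2) ℂ) (m : ℂ × ℂ → ℂ) :
    Prop where
  continuousOn : ContinuousOn m (surface a α)
  mulVec_eq : ∀ p ∈ surface a α, M p.1 *ᵥ eigenvector a α p = m p • eigenvector a α p

/-! ### The action and its local branches -/

/-- `s` is the branch of `R^{1/2}` near `z₀` with value `w₀` at `z₀`; equivalently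
`z ↦ (z, s z)` is the local inverse of the projection `(z, w) ↦ z` at the point `(z₀, w₀)`. -/
structure IsSqrtBranch (a α : ℝ) (z₀ w₀ : ℂ) (s : ℂ → ℂ) : Prop where
  value : s z₀ = w₀
  continuousAt : ∀ᶠ z in 𝓝 z₀, ContinuousAt s z
  sq_eq : ∀ᶠ z in 𝓝 z₀, s z ^ 2 = discR a α z

/-- `l` is a branch of `log f` near `z₀`. -/
structure IsLogBranch (f : ℂ → ℂ) (z₀ : ℂ) (l : ℂ → ℂ) : Prop where
  continuousAt : ∀ᶠ z in 𝓝 z₀, ContinuousAt l z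
  exp_eq : ∀ᶠ z in 𝓝 z₀, Complex.exp (l z) = f z

/-- `φ` is a branch near `z₀` of the multivalued action
`Φ = (1-τ) log μ - τ log ν + d (1-τ+ξ) log z - d (1-τ) log (z - a²)`,
in the local coordinate `z` of the surface given by the branch `s` of `R^{1/2}`. -/
def IsActionBranch (a : ℝ) (d : ℕ) (μ ν : ℂ × ℂ → ℂ) (τ ξ : ℝ) (s : ℂ → ℂ) (z₀ : ℂ)
    (φ : ℂ → ℂ) : Prop :=
  ∃ lμ lν l₀ l₁ : ℂ → ℂ,
    IsLogBranch (fun z => μ (z, s z)) z₀ lμ ∧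
    IsLogBranch (fun z => ν (z, s z)) z₀ lν ∧
    IsLogBranch (fun z => z) z₀ l₀ ∧
    IsLogBranch (fun z => z - (a : ℂ) ^ 2) z₀ l₁ ∧
    ∀ᶠ z in 𝓝 z₀, φ z =
      (1 - (τ : ℂ)) * lμ z - (τ : ℂ) * lν z + (d : ℂ) * (1 - (τ : ℂ) + (ξ : ℂ)) * l₀ z
        - (d : ℂ) * (1 - (τ : ℂ)) * l₁ z

end BiasedAztec

end

/-! The matrices `𝒫₋(p) 𝒫₊(p)` (`flowMatrix`) form an isospectral flow: swapping the two factors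
moves `p` to `σ(p)` (`IsStep.factorPlus_mul_factorMinus`), and at the initial point the matrix is
`P(z)` (`spectralMatrix`). Torsion closes the orbit after `d` steps, so `P₋^{(d)}` and `P₊^{(d)}`
commute with `P(z)`, and their product is `P(z)^d`. A matrix commuting with `P(z)` is affine in
`P(z)`; hence `μ` and `ν` exist as the same affine expressions in `λ`, and `μ ν = λ^d`, so only `μ`
needs a direct computation.

Let `λ̄` be the eigenvalue on the other sheet. Then `w = λ - λ̄`, and `(P - λ̄) / w` is the spectral
projection. First-order perturbation gives `μ'/μ = tr (M' M⁻¹ (P - λ̄)) / w` for `M = P₋^{(d)}`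
(`Commute.hasDerivAt_commutantEigenvalue`). Carrying `P` through the factors turns this trace into a
sum over the orbit (`exists_hasDerivAt_prod_map_range`): each factor contributes a multiple of `1 /
A_j`, where `A_j` is `fnA` at the `j`-th orbit point, and a term that does not depend on `j`.

Thus only `∑ 1 / A_j` enters. Because `A - a²α² / A` telescopes along the closed orbit
(`IsStep.fnA_sub`), `∑ A_j = a²α² ∑ 1 / A_j`, and the product of square roots defining `γ₁`
collapses to `-(aα/d) ∑ 1 / A_j`. The `ν` part follows from `ν'/ν = d λ'/λ - μ'/μ`. -/

noncomputable section

namespace BiasedAztec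

/-! ### Translation on the elliptic curve and the orbit on the oval. -/

/-- The quantity `(y - x) / (1 - a² x)`, to which `fnA` is proportional. -/
def chord (a : ℝ) (p : ℝ × ℝ) : ℝ := (p.2 - p.1) / (1 - a ^ 2 * p.1)

theorem curve_a₂_eq {a α : ℝ} (ha : 0 < a) (hα : 0 < α) :
    (curve a α).a₂ = 1 / yScale a α ^ 2 - a ^ 2 - 1 / a ^ 2 := by
  have h1 : 0 < a + 1 / a := by positivity
  have h2 : 0 < α + 1 / α := by positivity
  simp only [curve, yScale]
  field_simp
  ring

/-- The chord-and-tangent formula for adding the shift point to a point of the oval. -/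
theorem sigma_some {a α : ℝ} (ha : 0 < a) (hα : 0 < α) {x Y : ℝ}
    (h : (curve a α).Nonsingular x Y) (hx : x < 0) :
    ∃ (x' Y' : ℝ) (h' : (curve a α).Nonsingular x' Y'),
      sigma a α ha hα (.some x Y h) = .some x' Y' h' ∧
      x' = a ^ 2 / yScale a α ^ 2 * chord a (x, yScale a α * Y) ^ 2 / x ∧
      yScale a α * Y' = -((1 - a ^ 2 * chord a (x, yScale a α * Y)) * x'
        + chord a (x, yScale a α * Y)) := by
  have hk := yScale_pos ha hα
  have hb : 0 < 1 / a ^ 2 := by positivity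
  have hne : x ≠ 1 / a ^ 2 := by linarith
  have h2 : 0 < 1 - a ^ 2 * x := by nlinarith [pow_pos ha 2]
  have h3 : x - 1 / a ^ 2 ≠ 0 := sub_ne_zero.2 hne
  have heq := ((curve a α).equation_iff x Y).1 h.1
  rw [curve_a₂_eq ha hα] at heq
  simp only [curve] at heq
  have hslope : (curve a α).slope x (1 / a ^ 2) Y (1 / a ^ 2 / yScale a α)
      = (1 - a ^ 2 * yScale a α * Y) / (yScale a α * (1 - a ^ 2 * x)) := by
    rw [WeierstrassCurve.Affine.slope_of_X_ne hne]
    have h4 : x - 1 / a ^ 2 = -(1 - a ^ 2 * x) / a ^ 2 := by field_simp; ring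
    rw [h4]
    field_simp
    ring
  refine ⟨_, _, _, WeierstrassCurve.Affine.Point.add_of_X_ne hne, ?_, ?_⟩
  -- With `c = chord`, the line through both points is `y = (1 - a²c) x + c`. By Vieta the three
  -- abscissae multiply to `c² / yScale²`; the curve equation turns the sum-of-roots formula of
  -- `addX` into this product form.
  · rw [hslope, WeierstrassCurve.Affine.addX, curve_a₂_eq ha hα]
    simp only [curve, chord]
    generalize yScale a α = k at *
    have hx0 := hx.ne
    have hm : 1 - a ^ 2 * x ≠ 0 := h2.ne'
    generalize hmx : 1 - a ^ 2 * x = m at *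
    field_simp at heq ⊢
    subst hmx
    linear_combination (-a ^ 2 * (1 - a ^ 2 * x)) * heq
  · rw [WeierstrassCurve.Affine.addY, WeierstrassCurve.Affine.negY,
      WeierstrassCurve.Affine.negAddY, hslope]
    generalize (curve a α).addX x (1 / a ^ 2) _ = x'
    simp only [curve, chord]
    generalize yScale a α = k at *
    field_simp
    ring

/-- The points of the oval of the elliptic curve. -/
structure IsOvalPoint (a α : ℝ) (p : ℝ × ℝ) : Prop where
  neg : p.1 < 0
  eq : p.2 ^ 2 = p.1 ^ 2 +
      4 * p.1 * (p.1 - a ^ 2) * (p.1 - 1 / a ^ 2) / ((a + 1 / a) ^ 2 * (α + 1 / α) ^ 2)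

theorem IsOvalPoint.one_sub_pos {a α : ℝ} {p : ℝ × ℝ} (hp : IsOvalPoint a α p) :
    0 < 1 - a ^ 2 * p.1 := by
  nlinarith [sq_nonneg a, hp.neg]

/-- For `x < 0` the cubic term is negative, so `y² < x²` and `|y| < -x`. -/
theorem IsOvalPoint.lt {a α : ℝ} (ha : 0 < a) (hα : 0 < α) {p : ℝ × ℝ} (hp : IsOvalPoint a α p) :
    p.1 < p.2 := by
  have h1 : 0 < a + 1 / a := by positivity
  have h2 : 0 < α + 1 / α := by positivity
  have hb : 0 < 1 / a ^ 2 := by positivity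
  have hx := neg_pos.2 hp.neg
  have h3 : 0 < a ^ 2 - p.1 := by nlinarith [pow_pos ha 2]
  have h4 : 0 < 1 / a ^ 2 - p.1 := by linarith
  have : 0 < 4 * (-p.1) * (a ^ 2 - p.1) * (1 / a ^ 2 - p.1) /
      ((a + 1 / a) ^ 2 * (α + 1 / α) ^ 2) := by positivity
  have e : 4 * p.1 * (p.1 - a ^ 2) * (p.1 - 1 / a ^ 2)
      = -(4 * (-p.1) * (a ^ 2 - p.1) * (1 / a ^ 2 - p.1)) := by ring
  have h := hp.eq
  rw [e, neg_div] at h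
  nlinarith

/-- The product `x x'` of consecutive abscissae is a nonzero square, since `y > x` makes the chord
nonzero. Hence the sign `x < 0` persists, and the orbit stays on the oval, away from infinity and
from the shift point. -/
theorem orbit_succ {a α : ℝ} (ha : 0 < a) (hα : 0 < α) (hα1 : α < 1) (j : ℕ) :
    (orbit a α ha hα hα1 j).1 < 0 ∧
    (orbit a α ha hα hα1 j).2 ^ 2 = (orbit a α ha hα hα1 j).1 ^ 2 +
      4 * (orbit a α ha hα hα1 j).1 * ((orbit a α ha hα hα1 j).1 - a ^ 2) *
        ((orbit a α ha hα hα1 j).1 - 1 / a ^ 2) / ((a + 1 / a) ^ 2 * (α + 1 / α) ^ 2) ∧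
    (orbit a α ha hα hα1 (j + 1)).1 =
      a ^ 2 / yScale a α ^ 2 * chord a (orbit a α ha hα hα1 j) ^ 2 /
        (orbit a α ha hα hα1 j).1 ∧
    (orbit a α ha hα hα1 (j + 1)).2 =
      -((1 - a ^ 2 * chord a (orbit a α ha hα hα1 j)) * (orbit a α ha hα hα1 (j + 1)).1
        + chord a (orbit a α ha hα hα1 j)) := by
  have key : ∀ j : ℕ, ∃ (x Y : ℝ) (h : (curve a α).Nonsingular x Y),
      (sigma a α ha hα)^[j] (initialPoint a α ha hα hα1) = .some x Y h ∧ x < 0 := by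
    intro j
    induction j with
    | zero => exact ⟨_, _, _, rfl, by norm_num⟩
    | succ j ih =>
      obtain ⟨x, Y, h, e, hx⟩ := ih
      obtain ⟨x', Y', h', e', hx', -⟩ := sigma_some ha hα h hx
      refine ⟨x', Y', h', by rw [Function.iterate_succ_apply', e, e'], ?_⟩
      rw [hx']
      have hk := yScale_pos ha hα
      have hp : IsOvalPoint a α (x, yScale a α * Y) := ⟨hx, (curve_equation_iff ha hα x Y).1 h.1⟩
      have hc : chord a (x, yScale a α * Y) ≠ 0 :=
        (div_pos (sub_pos.2 (hp.lt ha hα)) hp.one_sub_pos).ne'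
      exact div_neg_of_pos_of_neg (by positivity) hx
  obtain ⟨x, Y, h, e, hx⟩ := key j
  obtain ⟨x', Y', h', e', hx', hy'⟩ := sigma_some ha hα h hx
  have o1 : orbit a α ha hα hα1 j = (x, yScale a α * Y) := by rw [orbit, e]; rfl
  have o2 : orbit a α ha hα hα1 (j + 1) = (x', yScale a α * Y') := by
    rw [orbit, Function.iterate_succ_apply', e, e']; rfl
  rw [o1, o2]
  exact ⟨hx, (curve_equation_iff ha hα x Y).1 h.1, hx', hy'⟩

theorem orbit_add_addOrderOf {a α : ℝ} (ha : 0 < a) (hα : 0 < α) (hα1 : α < 1) :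
    orbit a α ha hα hα1 (addOrderOf (shiftPoint a α ha hα)) = orbit a α ha hα hα1 0 := by
  have key : ∀ (j : ℕ) (p : (curve a α).Point),
      (sigma a α ha hα)^[j] p = p + j • shiftPoint a α ha hα := by
    intro j p
    induction j with
    | zero => simp
    | succ j ih => rw [Function.iterate_succ_apply', ih, sigma, succ_nsmul, add_assoc]
  rw [orbit, key, addOrderOf_nsmul_eq_zero, add_zero]; rfl

/-! ### The flow matrices and their refactorization. -/

/-- The upper left entry of `𝒫₋(p) 𝒫₊(p)`. -/
def diagUpper (a α : ℝ) (p : ℝ × ℝ) : ℝ := -(fnA a α p * (1 - a ^ 2 * p.1)) / (α * a * p.1)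

/-- The lower right entry of `𝒫₋(p) 𝒫₊(p)`. -/
def diagLower (a α : ℝ) (p : ℝ × ℝ) : ℝ := a * α * (a ^ 2 - p.1) / fnA a α p

/-- The trace of the matrices `𝒫₋(p) 𝒫₊(p)`. -/
def spectralTrace (a α : ℝ) : ℝ := (1 + a ^ 2) * (α + 1 / α)

/-- The product `𝒫₋(p) 𝒫₊(p)`. -/
def flowMatrix (a α : ℝ) (p : ℝ × ℝ) (z : ℂ) : Matrix (Fin 2) (Fin 2) ℂ :=
  !![(diagUpper a α p : ℂ), a * α * (z - p.1); -(a / (α * p.1)) * (1 / z - p.1), (diagLower a α p : ℂ)]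

/-- `q` is the point `σ(p)`. -/
structure IsStep (a α : ℝ) (p q : ℝ × ℝ) : Prop where
  fst_eq : q.1 = a ^ 2 / yScale a α ^ 2 * chord a p ^ 2 / p.1
  snd_eq : q.2 = -((1 - a ^ 2 * chord a p) * q.1 + chord a p)

section Flow

variable {a α : ℝ} {p q : ℝ × ℝ}

theorem fnA_eq (a α : ℝ) (p : ℝ × ℝ) :
    fnA a α p = a * (a ^ 2 + 1) * (α ^ 2 + 1) / 2 * chord a p := rfl

theorem IsOvalPoint.fnA_pos (ha : 0 < a) (hα : 0 < α) (hp : IsOvalPoint a α p) : 0 < fnA a α p := by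
  have h1 := hp.one_sub_pos
  have h2 := sub_pos.2 (hp.lt ha hα)
  unfold fnA
  positivity

theorem IsOvalPoint.fnD_eq (ha : 0 < a) (hα : 0 < α) (hp : IsOvalPoint a α p) :
    fnD a α p = -(α ^ 2 * p.1) / fnA a α p := by
  have h1 := hp.one_sub_pos.ne'
  have h2 := (sub_pos.2 (hp.lt ha hα)).ne'
  unfold fnD fnA
  have e : p.1 - 1 / a ^ 2 = -(1 - a ^ 2 * p.1) / a ^ 2 := by field_simp; ring
  rw [e]
  generalize 1 - a ^ 2 * p.1 = m at *
  generalize p.2 - p.1 = n at *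
  field_simp

/-- Substituting `y = x + c (1 - a²x)` into the curve equation leaves a common factor `1 - a²x`,
because the line passes through the shift point. Cancelling it gives the form of the curve equation
used in all later identities. -/
theorem IsOvalPoint.fnA_relation (ha : 0 < a) (hα : 0 < α) (hp : IsOvalPoint a α p) :
    fnA a α p ^ 2 = p.1 * (a ^ 2 * fnA a α p ^ 2 + a ^ 4 * α ^ 2 - a ^ 2 * α ^ 2 * p.1
      - a * α * spectralTrace a α * fnA a α p) := by
  have h1 := hp.one_sub_pos.ne'
  have h5 := hp.neg.ne
  have hy : p.2 = p.1 + chord a p * (1 - a ^ 2 * p.1) := by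
    rw [chord, div_mul_cancel₀ _ h1]; ring
  have h := hp.eq
  rw [hy] at h
  rw [fnA_eq]
  simp only [spectralTrace]
  generalize chord a p = k at *
  obtain ⟨x, y⟩ := p
  simp only at *
  have ht : (1 + a ^ 2) * (α + 1 / α) = (a ^ 2 + 1) * (α ^ 2 + 1) / α := by field_simp; ring
  have e : 4 * x * (x - a ^ 2) * (x - 1 / a ^ 2) / ((a + 1 / a) ^ 2 * (α + 1 / α) ^ 2)
      = -(4 * x * (x - a ^ 2) * (1 - a ^ 2 * x) * α ^ 2) /
        ((a ^ 2 + 1) * (α ^ 2 + 1)) ^ 2 := by field_simp; ring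
  have hB : (a ^ 2 + 1) * (α ^ 2 + 1) ≠ 0 := by positivity
  rw [e] at h
  rw [ht, mul_assoc a (a ^ 2 + 1)]
  generalize (a ^ 2 + 1) * (α ^ 2 + 1) = B at *
  rw [← sub_eq_iff_eq_add', eq_div_iff (by positivity)] at h
  refine mul_left_cancel₀ h1 ?_
  have e2 : a * α * (B / α) = a * B := by field_simp
  rw [e2]
  linear_combination a ^ 2 / 4 * h

theorem IsOvalPoint.diagUpper_add_diagLower (ha : 0 < a) (hα : 0 < α) (hp : IsOvalPoint a α p) :
    diagUpper a α p + diagLower a α p = spectralTrace a α := by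
  have h := hp.fnA_relation ha hα
  have hA := (hp.fnA_pos ha hα).ne'
  have hx := hp.neg.ne
  unfold diagUpper diagLower
  generalize fnA a α p = A at *
  generalize spectralTrace a α = t at *
  field_simp
  linear_combination -h

theorem IsStep.fst_eq' (ha : 0 < a) (hα : 0 < α) (hs : IsStep a α p q) :
    q.1 = fnA a α p ^ 2 / (a ^ 2 * α ^ 2 * p.1) := by
  rw [hs.fst_eq, fnA_eq, yScale]
  field_simp

/-- The right-hand side is the upper left entry of `𝒫₊(p) 𝒫₋(p)`. The lower right one then follows
from conservation of the trace. -/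
theorem IsStep.diagUpper_eq (ha : 0 < a) (hα : 0 < α) (hp : IsOvalPoint a α p)
    (hq : IsOvalPoint a α q)
    (hs : IsStep a α p q) :
    diagUpper a α q = -(fnA a α p - a ^ 4 * α ^ 2 * p.1 / fnA a α p) / (α * a * p.1) := by
  have h := hp.fnA_relation ha hα
  have hA := (hp.fnA_pos ha hα).ne'
  have hx := hp.neg.ne
  have e1 : fnA a α q * (1 - a ^ 2 * q.1)
      = a * (a ^ 2 + 1) * (α ^ 2 + 1) / 2 * (q.2 - q.1) := by
    rw [fnA_eq, chord]; have := hq.one_sub_pos.ne'; field_simp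
  have e2 : a * α * spectralTrace a α = a * (a ^ 2 + 1) * (α ^ 2 + 1) := by
    unfold spectralTrace; field_simp
    ring
  have e3 : a * (a ^ 2 + 1) * (α ^ 2 + 1) / 2 * (q.2 - q.1)
      = (-(a * α * spectralTrace a α) + a ^ 2 * fnA a α p) * q.1 - fnA a α p := by
    rw [hs.snd_eq, fnA_eq, e2]; ring
  rw [diagUpper, e1, e3, hs.fst_eq' ha hα]
  generalize fnA a α p = A at *
  generalize spectralTrace a α = t at *
  field_simp
  linear_combination h

theorem IsStep.diagLower_eq (ha : 0 < a) (hα : 0 < α) (hp : IsOvalPoint a α p)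
    (hq : IsOvalPoint a α q)
    (hs : IsStep a α p q) :
    diagLower a α q = a / α * (fnA a α p - α ^ 2 * p.1 / fnA a α p) := by
  have h1 := hq.diagUpper_add_diagLower ha hα
  rw [hs.diagUpper_eq ha hα hp hq] at h1
  have h := hp.fnA_relation ha hα
  have hA := (hp.fnA_pos ha hα).ne'
  have hx := hp.neg.ne
  rw [← eq_sub_iff_add_eq'] at h1
  rw [h1]
  generalize fnA a α p = A at *
  generalize spectralTrace a α = t at *
  field_simp
  linear_combination h

/-- The two diagonal entries share the term `-A / (αax)`, which cancels. Writing the result as a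
difference makes the sum over a closed orbit vanish. -/
theorem IsStep.fnA_sub (ha : 0 < a) (hα : 0 < α) (hp : IsOvalPoint a α p) (hq : IsOvalPoint a α q)
    (hs : IsStep a α p q) :
    fnA a α p - a ^ 2 * α ^ 2 * (1 / fnA a α p)
      = α / a * diagUpper a α p - α / a * diagUpper a α q := by
  have hA := (hp.fnA_pos ha hα).ne'
  have hx := hp.neg.ne
  rw [hs.diagUpper_eq ha hα hp hq, diagUpper]
  field_simp
  ring

theorem factorMinus_eq (a α : ℝ) (p : ℝ × ℝ) (z : ℂ) :
    factorMinus a α p z = (fnB a α p : ℂ) •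
      !![(fnA a α p : ℂ), (fnA a α p : ℂ) ^ 2; (a : ℂ) ^ 2 / z, (fnA a α p : ℂ)] := by
  simp [factorMinus, sq]

theorem factorPlus_eq (a α : ℝ) (p : ℝ × ℝ) (z : ℂ) :
    factorPlus a α p z = !![1, (a : ℂ) ^ 2 * z * fnD a α p;
      (a : ℂ) ^ 2 / (α : ℂ) ^ 2 * fnD a α p, (a : ℂ) ^ 2 / (α : ℂ) ^ 2 * (fnD a α p) ^ 2] := by
  simp [factorPlus, sq, mul_assoc]

theorem IsOvalPoint.factorMinus_mul_factorPlus (ha : 0 < a) (hα : 0 < α) (hp : IsOvalPoint a α p)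
    {z : ℂ} (hz : z ≠ 0) :
    factorMinus a α p z * factorPlus a α p z = flowMatrix a α p z := by
  have hA := Complex.ofReal_ne_zero.2 (hp.fnA_pos ha hα).ne'
  have hx := Complex.ofReal_ne_zero.2 hp.neg.ne
  have ha' := Complex.ofReal_ne_zero.2 ha.ne'
  have hα' := Complex.ofReal_ne_zero.2 hα.ne'
  rw [factorMinus_eq, factorPlus_eq, flowMatrix, hp.fnD_eq ha hα, fnB, diagUpper, diagLower,
    Matrix.smul_mul, Matrix.mul_fin_two, Matrix.smul_of]
  push_cast
  ext i j
  fin_cases i <;> fin_cases j <;> simp <;> field_simp <;> ring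

/-- This links the group law to the matrices: reversing the factorization is translation by the
shift point. -/
theorem IsStep.factorPlus_mul_factorMinus (ha : 0 < a) (hα : 0 < α) (hp : IsOvalPoint a α p)
    (hq : IsOvalPoint a α q)
    (hs : IsStep a α p q) {z : ℂ} (hz : z ≠ 0) :
    factorPlus a α p z * factorMinus a α p z = flowMatrix a α q z := by
  have hA := Complex.ofReal_ne_zero.2 (hp.fnA_pos ha hα).ne'
  have hx := Complex.ofReal_ne_zero.2 hp.neg.ne
  have ha' := Complex.ofReal_ne_zero.2 ha.ne'
  have hα' := Complex.ofReal_ne_zero.2 hα.ne'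
  rw [factorMinus_eq, factorPlus_eq, flowMatrix, hp.fnD_eq ha hα, fnB,
    hs.diagUpper_eq ha hα hp hq, hs.diagLower_eq ha hα hp hq, hs.fst_eq' ha hα,
    Matrix.mul_smul, Matrix.mul_fin_two, Matrix.smul_of]
  push_cast
  ext i j
  fin_cases i <;> fin_cases j <;> simp <;> field_simp <;> ring

theorem isOvalPoint_orbit (ha : 0 < a) (hα : 0 < α) (hα1 : α < 1) (j : ℕ) : IsOvalPoint a α
    (orbit a α ha hα hα1 j) :=
  ⟨(orbit_succ ha hα hα1 j).1, (orbit_succ ha hα hα1 j).2.1⟩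

theorem isStep_orbit (ha : 0 < a) (hα : 0 < α) (hα1 : α < 1) (j : ℕ) :
    IsStep a α (orbit a α ha hα hα1 j) (orbit a α ha hα hα1 (j + 1)) :=
  ⟨(orbit_succ ha hα hα1 j).2.2.1, (orbit_succ ha hα hα1 j).2.2.2⟩

theorem orbit_zero (ha : 0 < a) (hα : 0 < α) (hα1 : α < 1) :
    orbit a α ha hα hα1 0 = (-1, -((1 - α ^ 2) / (1 + α ^ 2))) := by
  have := (yScale_pos ha hα).ne'
  simp [orbit, initialPoint, coords]
  field_simp

/-- The matrix `P(z)`. -/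
def spectralMatrix (a α : ℝ) (z : ℂ) : Matrix (Fin 2) (Fin 2) ℂ :=
  !![(α : ℂ) * ((a : ℂ) ^ 2 + 1), a * α * (1 + z); a / α * (1 + 1 / z), ((a : ℂ) ^ 2 + 1) / α]

theorem flowMatrix_orbit_zero (ha : 0 < a) (hα : 0 < α) (hα1 : α < 1) (z : ℂ) :
    flowMatrix a α (orbit a α ha hα hα1 0) z = spectralMatrix a α z := by
  have hA : fnA a α (orbit a α ha hα hα1 0) = a * α ^ 2 := by
    rw [orbit_zero, fnA, show 1 - a ^ 2 * ((-1 : ℝ), -((1 - α ^ 2) / (1 + α ^ 2))).1 = 1 + a ^ 2 by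
      ring]
    field_simp; ring
  have ha' := Complex.ofReal_ne_zero.2 ha.ne'
  have hα' := Complex.ofReal_ne_zero.2 hα.ne'
  rw [flowMatrix, diagUpper, diagLower, hA, orbit_zero, spectralMatrix]
  push_cast
  ext i j
  fin_cases i <;> fin_cases j <;> simp [add_comm] <;> field_simp

/-- The sums of `a` and of `1 / a` over a closed orbit of the flow are proportional. -/
theorem sum_fnA_orbit (ha : 0 < a) (hα : 0 < α) (hα1 : α < 1) {d : ℕ}
    (hd : orbit a α ha hα hα1 d = orbit a α ha hα hα1 0) :
    ∑ j ∈ Finset.range d, fnA a α (orbit a α ha hα hα1 j)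
      = a ^ 2 * α ^ 2 * ∑ j ∈ Finset.range d, 1 / fnA a α (orbit a α ha hα hα1 j) := by
  rw [← sub_eq_zero, Finset.mul_sum, ← Finset.sum_sub_distrib]
  rw [Finset.sum_congr rfl fun j _ => (isStep_orbit ha hα hα1 j).fnA_sub ha hα
    (isOvalPoint_orbit ha hα hα1 j) (isOvalPoint_orbit ha hα hα1 (j + 1))]
  rw [Finset.sum_range_sub' fun j => α / a * diagUpper a α (orbit a α ha hα hα1 j), hd, sub_self]

end Flow

/-! ### Telescoping products in a monoid. -/

section Products

variable {R : Type*} [Monoid R]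

theorem mul_prod_map_range_of_intertwine {Q P : ℕ → R}
    (h : ∀ j, P j * Q j = Q j * P (j + 1)) (d : ℕ) :
    P 0 * ((List.range d).map Q).prod = ((List.range d).map Q).prod * P d := by
  induction d with
  | zero => simp
  | succ d ih =>
    rw [List.range_succ, List.map_append, List.prod_append, ← mul_assoc, ih, List.map_singleton,
      List.prod_singleton, mul_assoc, mul_assoc, h]

theorem mul_prod_reverse_map_range_of_intertwine {N P : ℕ → R}
    (h : ∀ j, P (j + 1) * N j = N j * P j) (d : ℕ) :
    P d * ((List.range d).map N).reverse.prod = ((List.range d).map N).reverse.prod * P 0 := by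
  induction d with
  | zero => simp
  | succ d ih =>
    rw [List.range_succ, List.map_append, List.reverse_append, List.prod_append, List.map_singleton,
      List.reverse_singleton, List.prod_singleton, ← mul_assoc, h, mul_assoc, ih, mul_assoc]

theorem prod_mul_prod_reverse_of_refactorization {Q N P : ℕ → R}
    (h₁ : ∀ j, Q j * N j = P j) (h₂ : ∀ j, N j * Q j = P (j + 1)) (d : ℕ) :
    ((List.range d).map Q).prod * ((List.range d).map N).reverse.prod = P 0 ^ d := by
  have h₃ : ∀ j, P j * Q j = Q j * P (j + 1) := fun j => by rw [← h₁, ← h₂, mul_assoc]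
  -- The power `P d ^ k` in the middle is needed for the induction: absorbing the innermost pair `Q
  -- d`, `N d` raises the exponent by one.
  have key : ∀ d k, ((List.range d).map Q).prod * P d ^ k * ((List.range d).map N).reverse.prod
      = P 0 ^ (d + k) := by
    intro d
    induction d with
    | zero => simp
    | succ d ih =>
      intro k
      have hk : Q d * P (d + 1) ^ k * N d = P d ^ (k + 1) := by
        have : Q d * P (d + 1) ^ k = P d ^ k * Q d := by
          have := (SemiconjBy.pow_right (show SemiconjBy (Q d) (P (d + 1)) (P d) from (h₃ d).symm) k)
          exact this
        rw [this, mul_assoc, h₁, pow_succ]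
      rw [List.range_succ, List.map_append, List.prod_append, List.map_append, List.reverse_append,
        List.prod_append, List.map_singleton, List.map_singleton, List.reverse_singleton,
        List.prod_singleton, List.prod_singleton, show d + 1 + k = d + (k + 1) by ring, ← ih, ← hk]
      simp only [mul_assoc]
  have := key d 0
  rwa [pow_zero, mul_one, add_zero] at this

end Products

/-! ### Matrices commuting with `P(z)`. -/

section Commutant

variable {a α : ℝ}

/-- The eigenvalue of a matrix `M` commuting with `P(z)` on the eigenvector of `P(z)` for the
eigenvalue `l`. -/
def commutantEigenvalue (a α : ℝ) (M : Matrix (Fin 2) (Fin 2) ℂ) (l : ℂ) : ℂ :=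
  M 0 0 + (M 1 1 - M 0 0) * (l - α * ((a : ℂ) ^ 2 + 1)) /
    (((a : ℂ) ^ 2 + 1) / α - α * ((a : ℂ) ^ 2 + 1))

/-- Dividing by the diagonal gap, nonzero because `α < 1`, keeps the formula for the eigenvalue
valid at `z = -1`, where the off-diagonal entries of `P(z)` vanish. -/
theorem diag_gap_ne_zero (hα : 0 < α) (hα1 : α < 1) :
    ((a : ℂ) ^ 2 + 1) / α - α * ((a : ℂ) ^ 2 + 1) ≠ 0 := by
  have h : (a ^ 2 + 1) / α - α * (a ^ 2 + 1) ≠ 0 := by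
    have : 0 < (a ^ 2 + 1) * (1 - α ^ 2) / α := by
      have : 0 < 1 - α ^ 2 := by nlinarith
      positivity
    rw [show (a ^ 2 + 1) / α - α * (a ^ 2 + 1) = (a ^ 2 + 1) * (1 - α ^ 2) / α by
      field_simp]
    exact this.ne'
  exact_mod_cast h

/-- A matrix that commutes with `P(z)` is an affine function of `P(z)`. -/
theorem Commute.eq_add_smul_spectralMatrix (hα : 0 < α) (hα1 : α < 1)
    {M : Matrix (Fin 2) (Fin 2) ℂ} {z : ℂ} (h : Commute M (spectralMatrix a α z)) :
    ∃ m₀ m₁ : ℂ, M = m₀ • 1 + m₁ • spectralMatrix a α z ∧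
      m₁ = (M 1 1 - M 0 0) / (((a : ℂ) ^ 2 + 1) / α - α * ((a : ℂ) ^ 2 + 1)) ∧
      ∀ l, commutantEigenvalue a α M l = m₀ + m₁ * l := by
  have hg := diag_gap_ne_zero (a := a) hα hα1
  have e := h.eq
  refine ⟨M 0 0 - (M 1 1 - M 0 0) / (((a : ℂ) ^ 2 + 1) / α - α * ((a : ℂ) ^ 2 + 1)) *
    (α * ((a : ℂ) ^ 2 + 1)), _, ?_, rfl, fun l => by rw [commutantEigenvalue]; ring⟩
  have h01 := congrFun (congrFun e 0) 1
  have h10 := congrFun (congrFun e 1) 0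
  simp only [spectralMatrix] at *
  simp only [Matrix.mul_apply, Fin.sum_univ_two, Matrix.of_apply,
    Matrix.cons_val', Matrix.cons_val_zero, Matrix.cons_val_one, Matrix.cons_val_fin_one] at h01 h10
  generalize (a : ℂ) / α * (1 + 1 / z) = c at *
  generalize (a : ℂ) * α * (1 + z) = b at *
  generalize ((a : ℂ) ^ 2 + 1) / α = g at *
  generalize (α : ℂ) * ((a : ℂ) ^ 2 + 1) = f at *
  ext i j
  fin_cases i <;> fin_cases j <;> simp <;> field_simp
  · linear_combination h01
  · linear_combination -h10
  · ring

/-- This is the characteristic equation of `P(z)`, equivalent to `w² = R(z)`. -/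
theorem lam_relation (hα : 0 < α) {p : ℂ × ℂ} (hp : p ∈ surface a α) :
    (lam a α p - α * ((a : ℂ) ^ 2 + 1)) * (lam a α p - ((a : ℂ) ^ 2 + 1) / α)
      = (a * α * (1 + p.1)) * (a / α * (1 + 1 / p.1)) := by
  have hα' := Complex.ofReal_ne_zero.2 hα.ne'
  obtain ⟨hz, hw⟩ := hp
  rw [discR] at hw
  rw [lam]
  field_simp at hw ⊢
  linear_combination hw

theorem spectralMatrix_mulVec (hα : 0 < α) {p : ℂ × ℂ} (hp : p ∈ surface a α) :
    spectralMatrix a α p.1 *ᵥ eigenvector a α p = lam a α p • eigenvector a α p := by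
  have h := lam_relation hα hp
  ext i
  fin_cases i
  · simp [spectralMatrix, eigenvector, Matrix.mulVec, dotProduct, Fin.sum_univ_two]
    ring
  · simp [spectralMatrix, eigenvector, Matrix.mulVec, dotProduct, Fin.sum_univ_two]
    simp only [one_div] at h
    linear_combination -h

theorem Commute.mulVec_eigenvector (hα : 0 < α) (hα1 : α < 1)
    {M : Matrix (Fin 2) (Fin 2) ℂ} {p : ℂ × ℂ} (hp : p ∈ surface a α)
    (h : Commute M (spectralMatrix a α p.1)) :
    M *ᵥ eigenvector a α p = commutantEigenvalue a α M (lam a α p) • eigenvector a α p := by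
  obtain ⟨m₀, m₁, hM, -, hl⟩ := Commute.eq_add_smul_spectralMatrix hα hα1 h
  rw [hl, add_smul, mul_smul, ← spectralMatrix_mulVec hα hp]
  conv_lhs => rw [hM]
  rw [Matrix.add_mulVec, Matrix.smul_mulVec, Matrix.smul_mulVec, Matrix.one_mulVec]

theorem isSurfaceEigenvalue_commutantEigenvalue (hα : 0 < α) (hα1 : α < 1)
    {M : ℂ → Matrix (Fin 2) (Fin 2) ℂ} (hM : ContinuousOn M {0}ᶜ)
    (h : ∀ z, z ≠ 0 → Commute (M z) (spectralMatrix a α z)) :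
    IsSurfaceEigenvalue a α M fun p => commutantEigenvalue a α (M p.1) (lam a α p) where
  continuousOn := by
    have h1 : ContinuousOn (fun p : ℂ × ℂ => M p.1) (surface a α) :=
      hM.comp continuousOn_fst fun p hp => hp.1
    have h2 : ∀ i j, ContinuousOn (fun p : ℂ × ℂ => M p.1 i j) (surface a α) := fun i j =>
      (continuous_apply_apply i j).comp_continuousOn h1
    have h3 : Continuous (lam a α) := by unfold lam; fun_prop
    unfold commutantEigenvalue
    exact (h2 0 0).add ((((h2 1 1).sub (h2 0 0)).mul (h3.continuousOn.sub continuousOn_const)).div_const _)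
  mulVec_eq p hp := Commute.mulVec_eigenvector hα hα1 hp (h p.1 hp.1)

end Commutant

/-! ### The `d`-fold products over a closed orbit. -/

section Total

variable {a α : ℝ} (ha : 0 < a) (hα : 0 < α) (hα1 : α < 1)

theorem commute_Pminus {d : ℕ} (hd : orbit a α ha hα hα1 d = orbit a α ha hα hα1 0) {z : ℂ}
    (hz : z ≠ 0) : Commute (Pminus a α ha hα hα1 d z) (spectralMatrix a α z) := by
  have h := mul_prod_map_range_of_intertwine
    (Q := fun j => factorMinus a α (orbit a α ha hα hα1 j) z)
    (P := fun j => flowMatrix a α (orbit a α ha hα hα1 j) z) (fun j => by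
      rw [← (isOvalPoint_orbit ha hα hα1 j).factorMinus_mul_factorPlus ha hα hz,
        ← (isStep_orbit ha hα hα1 j).factorPlus_mul_factorMinus ha hα (isOvalPoint_orbit ha hα hα1 j)
          (isOvalPoint_orbit ha hα hα1 (j + 1)) hz, mul_assoc]) d
  simp only [hd, flowMatrix_orbit_zero] at h
  exact h.symm

theorem commute_Pplus {d : ℕ} (hd : orbit a α ha hα hα1 d = orbit a α ha hα hα1 0) {z : ℂ}
    (hz : z ≠ 0) : Commute (Pplus a α ha hα hα1 d z) (spectralMatrix a α z) := by
  have h := mul_prod_reverse_map_range_of_intertwine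
    (N := fun j => factorPlus a α (orbit a α ha hα hα1 j) z)
    (P := fun j => flowMatrix a α (orbit a α ha hα hα1 j) z) (fun j => by
      rw [← (isOvalPoint_orbit ha hα hα1 j).factorMinus_mul_factorPlus ha hα hz,
        ← (isStep_orbit ha hα hα1 j).factorPlus_mul_factorMinus ha hα (isOvalPoint_orbit ha hα hα1 j)
          (isOvalPoint_orbit ha hα hα1 (j + 1)) hz, mul_assoc]) d
  simp only [hd, flowMatrix_orbit_zero] at h
  exact h.symm

theorem Pminus_mul_Pplus (d : ℕ) {z : ℂ} (hz : z ≠ 0) :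
    Pminus a α ha hα hα1 d z * Pplus a α ha hα hα1 d z = spectralMatrix a α z ^ d := by
  have h := prod_mul_prod_reverse_of_refactorization
    (Q := fun j => factorMinus a α (orbit a α ha hα hα1 j) z)
    (N := fun j => factorPlus a α (orbit a α ha hα hα1 j) z)
    (P := fun j => flowMatrix a α (orbit a α ha hα hα1 j) z)
    (fun j => (isOvalPoint_orbit ha hα hα1 j).factorMinus_mul_factorPlus ha hα hz)
    (fun j => (isStep_orbit ha hα hα1 j).factorPlus_mul_factorMinus ha hα
      (isOvalPoint_orbit ha hα hα1 j) (isOvalPoint_orbit ha hα hα1 (j + 1)) hz) d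
  simp only [flowMatrix_orbit_zero] at h
  exact h

theorem continuousOn_Pminus (d : ℕ) : ContinuousOn (Pminus a α ha hα hα1 d) {0}ᶜ := by
  unfold Pminus
  refine continuousOn_list_prod _ fun j _ => ?_
  change ContinuousOn (fun z => factorMinus a α (orbit a α ha hα hα1 j) z) _
  simp only [factorMinus_eq]
  refine continuousOn_pi.2 fun i => continuousOn_pi.2 fun k => ?_
  fin_cases i <;> fin_cases k <;> simp <;> try exact continuousOn_const
  exact continuousOn_const.mul (continuousOn_const.div continuousOn_id fun z hz => hz)

theorem continuousOn_Pplus (d : ℕ) : ContinuousOn (Pplus a α ha hα hα1 d) {0}ᶜ := by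
  have e : Pplus a α ha hα hα1 d = fun z =>
      ((List.range d).reverse.map fun j => factorPlus a α (orbit a α ha hα hα1 j) z).prod := by
    funext z; rw [Pplus, List.map_reverse]
  rw [e]
  refine continuousOn_list_prod _ fun j _ => ?_
  change ContinuousOn (fun z => factorPlus a α (orbit a α ha hα hα1 j) z) _
  simp only [factorPlus_eq]
  refine continuousOn_pi.2 fun i => continuousOn_pi.2 fun k => ?_
  fin_cases i <;> fin_cases k <;> simp <;> fun_prop

end Total

/-! ### Local branches of logarithms and of the square root. -/

section Branches

theorem IsLogBranch.ne_zero {f l : ℂ → ℂ} {z₀ : ℂ} (h : IsLogBranch f z₀ l) : f z₀ ≠ 0 := by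
  rw [← h.exp_eq.self_of_nhds]; exact Complex.exp_ne_zero _

/-- By continuity `l z - l z₀` has imaginary part in `(-π, π)` near `z₀`, so it is the principal
logarithm of `f z / f z₀`. -/
theorem IsLogBranch.hasDerivAt {f l : ℂ → ℂ} {z₀ f' : ℂ} (h : IsLogBranch f z₀ l)
    (hf : HasDerivAt f f' z₀) : HasDerivAt l (f' / f z₀) z₀ := by
  have h0 := h.ne_zero
  have h1 : HasDerivAt (fun z => l z₀ + Complex.log (f z / f z₀)) (f' / f z₀) z₀ := by
    have := ((hf.div_const (f z₀)).clog (by simp [div_self h0])).const_add (l z₀)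
    simpa [div_self h0] using this
  refine h1.congr_of_eventuallyEq ?_
  have hc : Filter.Tendsto (fun z => (l z - l z₀).im) (𝓝 z₀) (𝓝 0) := by
    have := Complex.continuous_im.continuousAt.tendsto.comp
      ((h.continuousAt.self_of_nhds.tendsto).sub_const (l z₀))
    simpa [Function.comp_def] using this
  filter_upwards [h.exp_eq, hc.eventually (gt_mem_nhds Real.pi_pos),
    hc.eventually (lt_mem_nhds (neg_lt_zero.2 Real.pi_pos))] with z hz h1 h2
  rw [← hz, ← h.exp_eq.self_of_nhds, ← Complex.exp_sub, Complex.log_exp h2 h1.le]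
  ring

theorem exists_isLogBranch {f : ℂ → ℂ} {z₀ : ℂ} (hf : ∀ᶠ z in 𝓝 z₀, ContinuousAt f z)
    (h0 : f z₀ ≠ 0) : ∃ l, IsLogBranch f z₀ l := by
  have hc : Filter.Tendsto (fun z => f z / f z₀) (𝓝 z₀) (𝓝 1) := by
    have := hf.self_of_nhds.tendsto.div_const (f z₀)
    rwa [div_self h0] at this
  have hs := hc.eventually (Complex.isOpen_slitPlane.mem_nhds Complex.one_mem_slitPlane)
  refine ⟨fun z => Complex.log (f z / f z₀) + Complex.log (f z₀), ?_, ?_⟩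
  · filter_upwards [hf, hs] with z hz h1
    exact ((hz.div_const _).clog h1).add continuousAt_const
  · filter_upwards [hs] with z h1
    rw [Complex.exp_add, Complex.exp_log (Complex.slitPlane_ne_zero h1), Complex.exp_log h0,
      div_mul_cancel₀ _ h0]

theorem hasDerivAt_discR (a α : ℝ) {z : ℂ} (hz : z ≠ 0) :
    HasDerivAt (discR a α) (4 * (a : ℂ) ^ 2 * (1 - 1 / z ^ 2)) z := by
  have h1 : HasDerivAt (fun z : ℂ => 1 - (a : ℂ) ^ 2 * z) (-((a : ℂ) ^ 2)) z := by
    simpa using ((hasDerivAt_id z).const_mul ((a : ℂ) ^ 2)).const_sub 1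
  have h2 : HasDerivAt (fun z : ℂ => 1 - (a : ℂ) ^ 2 / z) ((a : ℂ) ^ 2 / z ^ 2) z := by
    have := ((hasDerivAt_inv hz).const_mul ((a : ℂ) ^ 2)).const_sub 1
    simpa [div_eq_mul_inv] using this
  have h3 := ((h1.const_mul 4).mul h2).const_sub
    (((α : ℂ) + 1 / (α : ℂ)) ^ 2 * (1 + (a : ℂ) ^ 2) ^ 2)
  refine h3.congr_deriv ?_
  field_simp
  ring

variable {a α : ℝ} {z₀ w₀ : ℂ} {s : ℂ → ℂ}

/-- The difference quotient of `s` is that of `R` divided by `s z + w₀`, which tends to `2 w₀ ≠ 0`.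
-/
theorem IsSqrtBranch.hasDerivAt (h : IsSqrtBranch a α z₀ w₀ s) (hz : z₀ ≠ 0) (hw : w₀ ≠ 0) :
    HasDerivAt s (4 * (a : ℂ) ^ 2 * (1 - 1 / z₀ ^ 2) / (2 * w₀)) z₀ := by
  have hR := hasDerivAt_discR a α hz
  rw [hasDerivAt_iff_tendsto_slope] at hR ⊢
  have hc : Filter.Tendsto (fun z => s z + w₀) (𝓝 z₀) (𝓝 (2 * w₀)) := by
    have := h.continuousAt.self_of_nhds.tendsto.add_const w₀
    rwa [h.value, ← two_mul] at this
  have h2 : 2 * w₀ ≠ 0 := mul_ne_zero two_ne_zero hw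
  refine (hR.div (hc.mono_left nhdsWithin_le_nhds) h2).congr' ?_
  filter_upwards [nhdsWithin_le_nhds h.sq_eq, nhdsWithin_le_nhds (hc.eventually_ne h2)] with z h3 h4
  simp only [slope_def_field, Pi.div_apply]
  rw [← h3, ← h.sq_eq.self_of_nhds, h.value]
  field_simp
  ring

theorem IsSqrtBranch.eventually_mem_surface (h : IsSqrtBranch a α z₀ w₀ s) (hz : z₀ ≠ 0) :
    ∀ᶠ z in 𝓝 z₀, (z, s z) ∈ surface a α := by
  filter_upwards [h.sq_eq, isOpen_ne.mem_nhds hz] with z h1 h2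
  exact ⟨h2, h1⟩

theorem IsSqrtBranch.continuousAt_comp (h : IsSqrtBranch a α z₀ w₀ s) (hz : z₀ ≠ 0)
    {m : ℂ × ℂ → ℂ} (hm : ContinuousOn m (surface a α)) :
    ∀ᶠ z in 𝓝 z₀, ContinuousAt (fun z => m (z, s z)) z := by
  filter_upwards [h.continuousAt, (h.eventually_mem_surface hz).eventually_nhds] with z h1 h2
  have h3 := hm (z, s z) h2.self_of_nhds
  have h4 : Filter.Tendsto (fun z => (z, s z)) (𝓝 z) (𝓝[surface a α] (z, s z)) :=
    tendsto_nhdsWithin_iff.2 ⟨continuousAt_id.prodMk h1, h2⟩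
  exact h3.tendsto.comp h4

/-- The first coordinate of the eigenvector vanishes only over `z = -1`. The values therefore agree
on a punctured neighbourhood, and continuity settles the centre. -/
theorem IsSurfaceEigenvalue.eventuallyEq {M : ℂ → Matrix (Fin 2) (Fin 2) ℂ} {m n : ℂ × ℂ → ℂ}
    (ha : 0 < a) (hα : 0 < α) (hm : IsSurfaceEigenvalue a α M m) (hn : IsSurfaceEigenvalue a α M n)
    (h : IsSqrtBranch a α z₀ w₀ s) (hz : z₀ ≠ 0) :
    (fun z => m (z, s z)) =ᶠ[𝓝 z₀] fun z => n (z, s z) := by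
  rw [← (h.continuousAt_comp hz hm.continuousOn).self_of_nhds.eventuallyEq_nhds_iff_eventuallyEq_nhdsNE
    (h.continuousAt_comp hz hn.continuousOn).self_of_nhds]
  have h1 : ∀ᶠ z in 𝓝[≠] z₀, z ≠ -1 := by
    rcases eq_or_ne z₀ (-1) with e | e
    · rw [e]; exact self_mem_nhdsWithin
    · exact nhdsWithin_le_nhds (isOpen_ne.mem_nhds e)
  filter_upwards [h1, nhdsWithin_le_nhds (h.eventually_mem_surface hz)] with z h2 h3
  have e := congrFun ((hm.mulVec_eq _ h3).symm.trans (hn.mulVec_eq _ h3)) 0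
  have h4 : (a : ℂ) * α * (1 + z) ≠ 0 := by
    refine mul_ne_zero (mul_ne_zero ?_ ?_) fun h5 => h2 (by linear_combination h5)
    · exact Complex.ofReal_ne_zero.2 ha.ne'
    · exact Complex.ofReal_ne_zero.2 hα.ne'
  simpa [eigenvector] using mul_right_cancel₀ h4 (by simpa [eigenvector] using! e)

end Branches

/-! ### Logarithmic derivatives of matrix products. -/

section LogDerivative

variable {n : Type*} [Fintype n] [DecidableEq n]

/-- The logarithmic derivative of a product of matrices, traced against a matrix that is carried
through the factors. -/
theorem exists_hasDerivAt_prod_map_range {Q : ℕ → ℂ → Matrix n n ℂ} {Q' : ℕ → Matrix n n ℂ} {z : ℂ}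
    (hQ : ∀ j i k, HasDerivAt (fun z => Q j z i k) (Q' j i k) z)
    (hu : ∀ j, IsUnit (Q j z).det) (d : ℕ) :
    ∃ X : Matrix n n ℂ,
      (∀ i k, HasDerivAt (fun z => ((List.range d).map fun j => Q j z).prod i k) (X i k) z) ∧
      IsUnit (((List.range d).map fun j => Q j z).prod).det ∧
      -- One derivative `X` has to serve every carried family: it is used both for the flow matrices
      -- and for the constant family `1`.
      ∀ P : ℕ → Matrix n n ℂ, (∀ j, P j * Q j z = Q j z * P (j + 1)) →
        (X * (((List.range d).map fun j => Q j z).prod)⁻¹ * P 0).trace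
          = ∑ j ∈ Finset.range d, (Q' j * (Q j z)⁻¹ * P j).trace := by
  induction d with
  | zero => exact ⟨0, fun i k => by simpa using hasDerivAt_const z _, by simp, by simp⟩
  | succ d ih =>
    obtain ⟨X, hX, hM, hP⟩ := ih
    have e : ∀ z, ((List.range (d + 1)).map fun j => Q j z).prod
        = ((List.range d).map fun j => Q j z).prod * Q d z := fun z => by
      rw [List.range_succ, List.map_append, List.prod_append, List.map_singleton,
        List.prod_singleton]
    simp only [e]
    refine ⟨X * Q d z + ((List.range d).map fun j => Q j z).prod * Q' d, fun i k => ?_, ?_,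
      fun P hPQ => ?_⟩
    · simp only [Matrix.mul_apply, Matrix.add_apply, ← Finset.sum_add_distrib]
      exact HasDerivAt.fun_sum fun l _ => (hX i l).mul (hQ d l k)
    · rw [Matrix.det_mul]; exact hM.mul (hu d)
    · rw [Finset.sum_range_succ, ← hP P hPQ]
      have hc := mul_prod_map_range_of_intertwine hPQ d
      generalize ((List.range d).map fun j => Q j z).prod = M at *
      have hc' : M⁻¹ * P 0 = P d * M⁻¹ := by
        rw [← Matrix.mul_nonsing_inv_cancel_right M (M⁻¹ * P 0) hM, mul_assoc M⁻¹, hc, ← mul_assoc M⁻¹,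
          Matrix.nonsing_inv_mul M hM, one_mul]
      rw [Matrix.mul_inv_rev, add_mul, add_mul, Matrix.trace_add]
      congr 1
      · rw [mul_assoc X, ← mul_assoc (Q d z), Matrix.mul_nonsing_inv _ (hu d), one_mul]
      · rw [mul_assoc M, mul_assoc M, Matrix.trace_mul_comm]
        simp only [mul_assoc]
        rw [← mul_assoc M⁻¹ (P 0), hc', mul_assoc, Matrix.nonsing_inv_mul M hM, mul_one]

end LogDerivative

/-! ### First-order perturbation of the eigenvalue. -/

section Eigenvalues

variable {a α : ℝ}

/-- The eigenvalue of `P(z)` on the other sheet. -/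
def lamConj (a α : ℝ) (p : ℂ × ℂ) : ℂ :=
  1 / 2 * ((α : ℂ) + 1 / (α : ℂ)) * (1 + (a : ℂ) ^ 2) - 1 / 2 * p.2

theorem lam_add_lamConj (hα : 0 < α) (p : ℂ × ℂ) :
    lam a α p + lamConj a α p = α * ((a : ℂ) ^ 2 + 1) + ((a : ℂ) ^ 2 + 1) / α := by
  have hα' := Complex.ofReal_ne_zero.2 hα.ne'
  rw [lam, lamConj]
  field_simp
  ring

theorem lam_mul_lamConj {p : ℂ × ℂ} (hp : p ∈ surface a α) :
    lam a α p * lamConj a α p = (1 - (a : ℂ) ^ 2 * p.1) * (1 - (a : ℂ) ^ 2 / p.1) := by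
  obtain ⟨-, hw⟩ := hp
  rw [discR] at hw
  rw [lam, lamConj]
  linear_combination -1 / 4 * hw

/-- Unequal diagonal entries prevent `P(z)` from being scalar. So `P - λ̄` can replace the
eigenvector, and unlike it never vanishes. -/
theorem spectralMatrix_sub_lamConj_ne_zero (hα : 0 < α) (hα1 : α < 1) (z l : ℂ) :
    spectralMatrix a α z - l • 1 ≠ 0 := by
  intro h
  have h0 := congrFun (congrFun h 0) 0
  have h1 := congrFun (congrFun h 1) 1
  simp [spectralMatrix] at h0 h1
  exact diag_gap_ne_zero (a := a) hα hα1 (by linear_combination h1 - h0)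

theorem spectralMatrix_mul_sub_lamConj (hα : 0 < α) {p : ℂ × ℂ} (hp : p ∈ surface a α) :
    spectralMatrix a α p.1 * (spectralMatrix a α p.1 - lamConj a α p • 1)
      = lam a α p • (spectralMatrix a α p.1 - lamConj a α p • 1) := by
  have h1 := lam_add_lamConj (a := a) hα p
  have h2 := lam_relation hα hp
  rw [← eq_sub_iff_add_eq'] at h1
  rw [h1]
  simp only [spectralMatrix]
  generalize (a : ℂ) / α * (1 + 1 / p.1) = c at *
  generalize (a : ℂ) * α * (1 + p.1) = b at *
  generalize ((a : ℂ) ^ 2 + 1) / α = g at *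
  generalize (α : ℂ) * ((a : ℂ) ^ 2 + 1) = f at *
  ext i j
  fin_cases i <;> fin_cases j <;> simp [Matrix.mul_apply, Fin.sum_univ_two]
  · linear_combination -h2
  · ring
  · ring
  · linear_combination -h2

theorem Commute.mul_sub_lamConj (hα : 0 < α) (hα1 : α < 1) {M : Matrix (Fin 2) (Fin 2) ℂ}
    {p : ℂ × ℂ} (hp : p ∈ surface a α) (h : Commute M (spectralMatrix a α p.1)) :
    M * (spectralMatrix a α p.1 - lamConj a α p • 1)
      = commutantEigenvalue a α M (lam a α p) •
        (spectralMatrix a α p.1 - lamConj a α p • 1) := by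
  obtain ⟨m₀, m₁, hM, -, hl⟩ := Commute.eq_add_smul_spectralMatrix hα hα1 h
  rw [hl, add_smul, mul_smul, ← spectralMatrix_mul_sub_lamConj hα hp]
  conv_lhs => rw [hM]
  rw [add_mul, smul_mul_assoc, smul_mul_assoc, one_mul]

theorem Commute.commutantEigenvalue_ne_zero (hα : 0 < α) (hα1 : α < 1)
    {M : Matrix (Fin 2) (Fin 2) ℂ} {p : ℂ × ℂ} (hp : p ∈ surface a α)
    (h : Commute M (spectralMatrix a α p.1)) (hM : IsUnit M.det) :
    commutantEigenvalue a α M (lam a α p) ≠ 0 := by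
  intro h0
  have e := Commute.mul_sub_lamConj hα hα1 hp h
  rw [h0, zero_smul] at e
  have := Matrix.nonsing_inv_mul_cancel_left M (spectralMatrix a α p.1 - lamConj a α p • 1) hM
  rw [e, mul_zero] at this
  exact spectralMatrix_sub_lamConj_ne_zero hα hα1 _ _ this.symm

theorem Commute.commutantEigenvalue_mul (hα : 0 < α) (hα1 : α < 1)
    {M N : Matrix (Fin 2) (Fin 2) ℂ} {p : ℂ × ℂ} (hp : p ∈ surface a α)
    (hM : Commute M (spectralMatrix a α p.1)) (hN : Commute N (spectralMatrix a α p.1))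
    {d : ℕ} (h : M * N = spectralMatrix a α p.1 ^ d) :
    commutantEigenvalue a α M (lam a α p) * commutantEigenvalue a α N (lam a α p)
      = lam a α p ^ d := by
  have h1 : ∀ d : ℕ, spectralMatrix a α p.1 ^ d * (spectralMatrix a α p.1 - lamConj a α p • 1)
      = lam a α p ^ d • (spectralMatrix a α p.1 - lamConj a α p • 1) := by
    intro d
    induction d with
    | zero => simp
    | succ d ih =>
      rw [pow_succ, mul_assoc, spectralMatrix_mul_sub_lamConj hα hp, mul_smul_comm, ih, smul_smul,
        pow_succ']
  have h2 := h1 d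
  rw [← h, mul_assoc, Commute.mul_sub_lamConj hα hα1 hp hN, mul_smul_comm,
    Commute.mul_sub_lamConj hα hα1 hp hM, smul_smul, mul_comm (commutantEigenvalue a α N _)] at h2
  exact smul_left_injective ℂ (spectralMatrix_sub_lamConj_ne_zero hα hα1 _ _) h2

theorem Commute.hasDerivAt_commutantEigenvalue (hα : 0 < α) (hα1 : α < 1)
    {M : ℂ → Matrix (Fin 2) (Fin 2) ℂ} {X : Matrix (Fin 2) (Fin 2) ℂ} {z w : ℂ} {s : ℂ → ℂ}
    (hp : (z, w) ∈ surface a α) (hw : w ≠ 0) (hs : IsSqrtBranch a α z w s)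
    (hM : ∀ z, z ≠ 0 → Commute (M z) (spectralMatrix a α z)) (hu : IsUnit (M z).det)
    (hX : ∀ i j, HasDerivAt (fun z => M z i j) (X i j) z) :
    HasDerivAt (fun z => commutantEigenvalue a α (M z) (lam a α (z, s z)))
      (commutantEigenvalue a α (M z) (lam a α (z, w)) *
        (((X * (M z)⁻¹ * spectralMatrix a α z).trace
          - lamConj a α (z, w) * (X * (M z)⁻¹ * 1).trace) / w)) z := by
  have hz : z ≠ 0 := hp.1
  have hα' := Complex.ofReal_ne_zero.2 hα.ne'
  have hg := diag_gap_ne_zero (a := a) hα hα1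
  have hl : HasDerivAt (fun z => lam a α (z, s z))
      (1 / 2 * (4 * (a : ℂ) ^ 2 * (1 - 1 / z ^ 2) / (2 * w))) z := by
    unfold lam
    exact ((hs.hasDerivAt hz hw).const_mul (1 / 2)).const_add _
  have hF := (hX 0 0).add ((((hX 1 1).sub (hX 0 0)).mul (hl.sub_const
    ((α : ℂ) * ((a : ℂ) ^ 2 + 1)))).div_const
      (((a : ℂ) ^ 2 + 1) / α - α * ((a : ℂ) ^ 2 + 1)))
  simp only [Pi.sub_apply, hs.value] at hF
  refine hF.congr_deriv ?_
  -- the trace against the spectral projection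
  have htr : commutantEigenvalue a α (M z) (lam a α (z, w)) *
      ((X * (M z)⁻¹ * spectralMatrix a α z).trace
        - lamConj a α (z, w) * (X * (M z)⁻¹ * 1).trace)
      = (X * (spectralMatrix a α z - lamConj a α (z, w) • 1)).trace := by
    have e := Commute.mul_sub_lamConj hα hα1 hp (hM z hz)
    have e2 := Matrix.nonsing_inv_mul_cancel_left (M z)
      (spectralMatrix a α z - lamConj a α (z, w) • 1) hu
    simp only at e
    rw [e] at e2
    have e3 : (X * (M z)⁻¹ * (spectralMatrix a α z - lamConj a α (z, w) • 1)).trace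
        = (X * (M z)⁻¹ * spectralMatrix a α z).trace
          - lamConj a α (z, w) * (X * (M z)⁻¹ * 1).trace := by
      rw [mul_sub, Matrix.trace_sub, mul_smul_comm, Matrix.trace_smul, smul_eq_mul]
    rw [← e3]
    conv_rhs => rw [← e2]
    rw [mul_smul_comm, mul_smul_comm, Matrix.trace_smul, smul_eq_mul, ← mul_assoc]
  -- the off-diagonal entries are determined by the diagonal ones
  set g : ℂ := ((a : ℂ) ^ 2 + 1) / α with hgdef
  set f : ℂ := (α : ℂ) * ((a : ℂ) ^ 2 + 1) with hfdef
  have hq : HasDerivAt (fun z => (M z 1 1 - M z 0 0) / (g - f)) ((X 1 1 - X 0 0) / (g - f)) z :=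
    ((hX 1 1).sub (hX 0 0)).div_const _
  have hb : HasDerivAt (fun z : ℂ => (a : ℂ) * α * (1 + z)) ((a : ℂ) * α) z := by
    simpa using ((hasDerivAt_id z).const_add 1).const_mul ((a : ℂ) * α)
  have hc : HasDerivAt (fun z : ℂ => (a : ℂ) / α * (1 + 1 / z)) ((a : ℂ) / α * (-1 / z ^ 2)) z := by
    have := ((hasDerivAt_inv hz).const_add 1).const_mul ((a : ℂ) / α)
    simpa [div_eq_mul_inv] using this
  have hoff : ∀ z, z ≠ 0 → M z 0 1 = (M z 1 1 - M z 0 0) / (g - f) * (a * α * (1 + z)) ∧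
      M z 1 0 = (M z 1 1 - M z 0 0) / (g - f) * (a / α * (1 + 1 / z)) := by
    intro z hz
    obtain ⟨m₀, m₁, h1, h2, -⟩ := Commute.eq_add_smul_spectralMatrix hα hα1 (hM z hz)
    rw [← h2]
    constructor
    · conv_lhs => rw [h1]
      simp [spectralMatrix]
    · conv_lhs => rw [h1]
      simp [spectralMatrix]
  have h01 : X 0 1 = (X 1 1 - X 0 0) / (g - f) * (a * α * (1 + z))
      + (M z 1 1 - M z 0 0) / (g - f) * (a * α) := by
    refine (hX 0 1).unique ((hq.mul hb).congr_of_eventuallyEq ?_)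
    filter_upwards [isOpen_ne.mem_nhds hz] with z hz using (hoff z hz).1
  have h10 : X 1 0 = (X 1 1 - X 0 0) / (g - f) * (a / α * (1 + 1 / z))
      + (M z 1 1 - M z 0 0) / (g - f) * (a / α * (-1 / z ^ 2)) := by
    refine (hX 1 0).unique ((hq.mul hc).congr_of_eventuallyEq ?_)
    filter_upwards [isOpen_ne.mem_nhds hz] with z hz using (hoff z hz).2
  have hrel := lam_relation hα hp
  have hsum := lam_add_lamConj (a := a) hα (z, w)
  have hdiff : lam a α (z, w) - lamConj a α (z, w) = w := by simp only [lam, lamConj]; ring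
  have hXtr : (X * (spectralMatrix a α z - lamConj a α (z, w) • 1)).trace
      = X 0 0 * (f - lamConj a α (z, w)) + X 0 1 * (a / α * (1 + 1 / z))
        + X 1 0 * (a * α * (1 + z)) + X 1 1 * (g - lamConj a α (z, w)) := by
    simp [Matrix.trace, Matrix.mul_apply, Fin.sum_univ_two, spectralMatrix, hgdef, hfdef]
    ring
  rw [← mul_div_assoc (commutantEigenvalue a α (M z) (lam a α (z, w))), htr, hXtr, h01, h10, eq_div_iff hw]
  have hder : (a : ℂ) * α * (a / α * (1 + 1 / z)) + a / α * (-1 / z ^ 2) * (a * α * (1 + z))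
      = (a : ℂ) ^ 2 * (1 - 1 / z ^ 2) := by
    field_simp
    ring
  have h11 : X 1 1 = X 0 0 + (X 1 1 - X 0 0) / (g - f) * (g - f) := by
    rw [div_mul_cancel₀ _ hg]; ring
  have hlc : lamConj a α (z, w) = f + g - lam a α (z, w) := by
    rw [← hsum]; ring
  have hwe : 2 * lam a α (z, w) - f - g = w := by
    linear_combination hdiff + hlc
  have hw2 : 1 / 2 * (4 * (a : ℂ) ^ 2 * (1 - 1 / z ^ 2) / (2 * w)) * w
      = (a : ℂ) ^ 2 * (1 - 1 / z ^ 2) := by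
    field_simp
    ring
  simp only at hrel
  rw [← hgdef, ← hfdef] at hrel
  rw [hlc]
  generalize lam a α (z, w) = l at *
  generalize hQ' : (X 1 1 - X 0 0) / (g - f) = q' at *
  generalize hQ : (M z 1 1 - M z 0 0) / (g - f) = q at *
  generalize (1 : ℂ) / 2 * (4 * (a : ℂ) ^ 2 * (1 - 1 / z ^ 2) / (2 * w)) = l' at *
  have hleft : X 0 0 + ((X 1 1 - X 0 0) * (l - f) + (M z 1 1 - M z 0 0) * l') / (g - f)
      = X 0 0 + q' * (l - f) + q * l' := by
    rw [← hQ', ← hQ]; field_simp; ring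
  rw [hleft, h11]
  generalize (a : ℂ) / α * (1 + 1 / z) = c at *
  generalize (a : ℂ) * α * (1 + z) = b at *
  rw [add_mul, mul_assoc q, hw2, ← hder, ← hwe]
  -- The terms containing `q` already agree through `hder`; those containing `q'` differ by the
  -- characteristic equation.
  linear_combination (2 * q') * hrel

end Eigenvalues

/-! ### The eigenvalue of `P₋^{(d)}` and its logarithmic derivative. -/

section Minus

variable {a α : ℝ}

/-- The derivative of `𝒫₋(p)` with respect to `z`. -/
def factorMinusDeriv (a α : ℝ) (p : ℝ × ℝ) (z : ℂ) : Matrix (Fin 2) (Fin 2) ℂ :=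
  !![0, 0; (fnB a α p : ℂ) * (-((a : ℂ) ^ 2 / z ^ 2)), 0]

theorem hasDerivAt_factorMinus (a α : ℝ) (p : ℝ × ℝ) {z : ℂ} (hz : z ≠ 0) (i k : Fin 2) :
    HasDerivAt (fun z => factorMinus a α p z i k) (factorMinusDeriv a α p z i k) z := by
  simp only [factorMinus_eq]
  fin_cases i <;> fin_cases k <;> simp [factorMinusDeriv] <;> try exact hasDerivAt_const z _
  have := ((hasDerivAt_inv hz).const_mul ((a : ℂ) ^ 2)).const_mul (fnB a α p : ℂ)
  simpa [div_eq_mul_inv] using this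

theorem det_factorMinus (a α : ℝ) (p : ℝ × ℝ) (z : ℂ) :
    (factorMinus a α p z).det
      = (fnB a α p : ℂ) ^ 2 * (fnA a α p : ℂ) ^ 2 * (1 - (a : ℂ) ^ 2 / z) := by
  rw [factorMinus_eq, Matrix.det_smul, Matrix.det_fin_two_of, Fintype.card_fin]
  ring

variable {p : ℝ × ℝ} {z : ℂ}

theorem one_sub_div_ne_zero (hz : z ≠ 0) (hz' : z ≠ (a : ℂ) ^ 2) : 1 - (a : ℂ) ^ 2 / z ≠ 0 := by
  rw [one_sub_div hz]
  exact div_ne_zero (sub_ne_zero.2 hz') hz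

theorem IsOvalPoint.fnB_ne_zero (ha : 0 < a) (hα : 0 < α) (hp : IsOvalPoint a α p) :
    fnB a α p ≠ 0 :=
  neg_ne_zero.2 (one_div_ne_zero (mul_ne_zero (mul_pos hα ha).ne' hp.neg.ne))

theorem IsOvalPoint.isUnit_det_factorMinus (ha : 0 < a) (hα : 0 < α) (hp : IsOvalPoint a α p)
    (hz : z ≠ 0) (hz' : z ≠ (a : ℂ) ^ 2) : IsUnit (factorMinus a α p z).det := by
  rw [det_factorMinus, isUnit_iff_ne_zero]
  have h1 := Complex.ofReal_ne_zero.2 (hp.fnB_ne_zero ha hα)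
  have h2 := Complex.ofReal_ne_zero.2 (hp.fnA_pos ha hα).ne'
  exact mul_ne_zero (mul_ne_zero (pow_ne_zero 2 h1) (pow_ne_zero 2 h2)) (one_sub_div_ne_zero hz hz')

theorem IsOvalPoint.trace_logDeriv_factorMinus (ha : 0 < a) (hα : 0 < α) (hp : IsOvalPoint a α p)
    (hz : z ≠ 0) (hz' : z ≠ (a : ℂ) ^ 2) :
    (factorMinusDeriv a α p z * (factorMinus a α p z)⁻¹ * 1).trace
      = (a : ℂ) ^ 2 / (z * (z - (a : ℂ) ^ 2)) := by
  have h1 := Complex.ofReal_ne_zero.2 (hp.fnB_ne_zero ha hα)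
  have h2 := Complex.ofReal_ne_zero.2 (hp.fnA_pos ha hα).ne'
  have h3 := sub_ne_zero.2 hz'
  rw [mul_one, Matrix.inv_def, det_factorMinus, Ring.inverse_eq_inv', Matrix.mul_smul,
    Matrix.trace_smul, factorMinus_eq, Matrix.adjugate_smul, Matrix.adjugate_fin_two_of,
    factorMinusDeriv, one_sub_div hz]
  simp [Matrix.trace, Fin.sum_univ_two]
  field_simp

/-- Since the flow matrix is `𝒫₋ 𝒫₊`, the inverse cancels and the trace is that of `𝒫₋' 𝒫₊`, which
has a single nonzero term. -/
theorem IsOvalPoint.trace_logDeriv_factorMinus_mul (ha : 0 < a) (hα : 0 < α)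
    (hp : IsOvalPoint a α p) (hz : z ≠ 0) (hz' : z ≠ (a : ℂ) ^ 2) :
    (factorMinusDeriv a α p z * (factorMinus a α p z)⁻¹ * flowMatrix a α p z).trace
      = -((a : ℂ) ^ 3 * α / z) * ((1 / fnA a α p : ℝ) : ℂ) := by
  have h2 := Complex.ofReal_ne_zero.2 (hp.fnA_pos ha hα).ne'
  have hx := Complex.ofReal_ne_zero.2 hp.neg.ne
  have ha' := Complex.ofReal_ne_zero.2 ha.ne'
  have hα' := Complex.ofReal_ne_zero.2 hα.ne'
  rw [← hp.factorMinus_mul_factorPlus ha hα hz, mul_assoc, Matrix.nonsing_inv_mul_cancel_left _ _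
    (hp.isUnit_det_factorMinus ha hα hz hz'), factorPlus_eq, factorMinusDeriv, hp.fnD_eq ha hα, fnB]
  simp [Matrix.trace, Fin.sum_univ_two]
  field_simp

variable (ha : 0 < a) (hα : 0 < α) (hα1 : α < 1)

/-- The eigenvalue of `P₋^{(d)}` on the spectral surface. -/
def eigenvalueMinus (d : ℕ) (p : ℂ × ℂ) : ℂ :=
  commutantEigenvalue a α (Pminus a α ha hα hα1 d p.1) (lam a α p)

/-- The eigenvalue of `P₊^{(d)}` on the spectral surface. -/
def eigenvaluePlus (d : ℕ) (p : ℂ × ℂ) : ℂ :=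
  commutantEigenvalue a α (Pplus a α ha hα hα1 d p.1) (lam a α p)

variable {d : ℕ}

theorem isSurfaceEigenvalue_eigenvalueMinus
    (hd : orbit a α ha hα hα1 d = orbit a α ha hα hα1 0) :
    IsSurfaceEigenvalue a α (Pminus a α ha hα hα1 d) (eigenvalueMinus ha hα hα1 d) :=
  isSurfaceEigenvalue_commutantEigenvalue hα hα1 (continuousOn_Pminus ha hα hα1 d)
    fun _ hz => commute_Pminus ha hα hα1 hd hz

theorem isSurfaceEigenvalue_eigenvaluePlus
    (hd : orbit a α ha hα hα1 d = orbit a α ha hα hα1 0) :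
    IsSurfaceEigenvalue a α (Pplus a α ha hα hα1 d) (eigenvaluePlus ha hα hα1 d) :=
  isSurfaceEigenvalue_commutantEigenvalue hα hα1 (continuousOn_Pplus ha hα hα1 d)
    fun _ hz => commute_Pplus ha hα hα1 hd hz

theorem eigenvalueMinus_mul_eigenvaluePlus
    (hd : orbit a α ha hα hα1 d = orbit a α ha hα hα1 0) {p : ℂ × ℂ} (hp : p ∈ surface a α) :
    eigenvalueMinus ha hα hα1 d p * eigenvaluePlus ha hα hα1 d p = lam a α p ^ d :=
  Commute.commutantEigenvalue_mul hα hα1 hp (commute_Pminus ha hα hα1 hd hp.1)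
    (commute_Pplus ha hα hα1 hd hp.1) (Pminus_mul_Pplus ha hα hα1 d hp.1)

theorem hasDerivAt_eigenvalueMinus
    (hd : orbit a α ha hα hα1 d = orbit a α ha hα hα1 0) {w : ℂ} {s : ℂ → ℂ} (hp : (z, w) ∈ surface a α) (hw : w ≠ 0)
    (hz' : z ≠ (a : ℂ) ^ 2) (hs : IsSqrtBranch a α z w s) :
    eigenvalueMinus ha hα hα1 d (z, w) ≠ 0 ∧
    HasDerivAt (fun z => eigenvalueMinus ha hα hα1 d (z, s z))
      (eigenvalueMinus ha hα hα1 d (z, w) *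
        ((-((a : ℂ) ^ 3 * α / z) *
            ((∑ j ∈ Finset.range d, 1 / fnA a α (orbit a α ha hα hα1 j) : ℝ) : ℂ)
          - lamConj a α (z, w) * (d * ((a : ℂ) ^ 2 / (z * (z - (a : ℂ) ^ 2))))) / w)) z := by
  have hz : z ≠ 0 := hp.1
  have ho := isOvalPoint_orbit ha hα hα1
  obtain ⟨X, hX, hu, hT⟩ := exists_hasDerivAt_prod_map_range
    (Q := fun j z => factorMinus a α (orbit a α ha hα hα1 j) z)
    (Q' := fun j => factorMinusDeriv a α (orbit a α ha hα hα1 j) z) (z := z)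
    (fun j => hasDerivAt_factorMinus a α _ hz)
    (fun j => (ho j).isUnit_det_factorMinus ha hα hz hz') d
  have h1 := hT (fun j => flowMatrix a α (orbit a α ha hα hα1 j) z) fun j => by
    rw [← (ho j).factorMinus_mul_factorPlus ha hα hz,
      ← (isStep_orbit ha hα hα1 j).factorPlus_mul_factorMinus ha hα (ho j) (ho (j + 1)) hz,
      mul_assoc]
  have h2 := hT (fun _ => 1) fun j => by rw [one_mul, mul_one]
  rw [Finset.sum_congr rfl fun j _ => (ho j).trace_logDeriv_factorMinus_mul ha hα hz hz',
    ← Finset.mul_sum, ← Complex.ofReal_sum] at h1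
  rw [Finset.sum_congr rfl fun j _ => (ho j).trace_logDeriv_factorMinus ha hα hz hz',
    Finset.sum_const, Finset.card_range, nsmul_eq_mul] at h2
  simp only [flowMatrix_orbit_zero] at h1
  have hc := fun z hz => commute_Pminus ha hα hα1 (z := z) hd hz
  refine ⟨Commute.commutantEigenvalue_ne_zero hα hα1 hp (hc z hz) hu, ?_⟩
  have h3 := Commute.hasDerivAt_commutantEigenvalue hα hα1 hp hw hs hc hu hX
  unfold Pminus at h3
  rw [h1, h2] at h3
  exact h3

end Minus

/-- The constant `γ₁` of a closed orbit in terms of one of the two averages. -/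
theorem sqrt_average_mul_sqrt_average {a α S T : ℝ} (ha : 0 < a) (hα : 0 < α) (hT : 0 ≤ T)
    (h : S = a ^ 2 * α ^ 2 * T) (d : ℕ) :
    Real.sqrt (1 / (d : ℝ) * S) * Real.sqrt (1 / (d : ℝ) * T) = 1 / (d : ℝ) * (a * α * T) := by
  rw [h, show 1 / (d : ℝ) * (a ^ 2 * α ^ 2 * T) = (a * α) ^ 2 * (1 / (d : ℝ) * T) by ring,
    Real.sqrt_mul (by positivity), Real.sqrt_sq (by positivity), mul_assoc,
    Real.mul_self_sqrt (by positivity)]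
  ring

end BiasedAztec

end

/-! ### Assembly of the derivative of the action. -/

theorem proposition3p6 (a α : ℝ) (ha0 : 0 < a) (ha1 : a ≤ 1) (hα0 : 0 < α) (hα1 : α < 1)
    (d : ℕ) (hd : 0 < d) (hord : addOrderOf (BiasedAztec.shiftPoint a α ha0 hα0) = d) :
    (∃ μ : ℂ × ℂ → ℂ, BiasedAztec.IsSurfaceEigenvalue a α
      (BiasedAztec.Pminus a α ha0 hα0 hα1 d) μ) ∧
    (∃ ν : ℂ × ℂ → ℂ, BiasedAztec.IsSurfaceEigenvalue a α
      (BiasedAztec.Pplus a α ha0 hα0 hα1 d) ν) ∧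
    ∀ μ ν : ℂ × ℂ → ℂ,
      BiasedAztec.IsSurfaceEigenvalue a α (BiasedAztec.Pminus a α ha0 hα0 hα1 d) μ →
      BiasedAztec.IsSurfaceEigenvalue a α (BiasedAztec.Pplus a α ha0 hα0 hα1 d) ν →
      ∀ γ₁ γ₂ γ₃ : ℝ,
        γ₁ = -(Real.sqrt (1 / (d : ℝ) * ∑ j ∈ Finset.range d,
                BiasedAztec.fnA a α (BiasedAztec.orbit a α ha0 hα0 hα1 j)) *
              Real.sqrt (1 / (d : ℝ) * ∑ k ∈ Finset.range d,
                1 / BiasedAztec.fnA a α (BiasedAztec.orbit a α ha0 hα0 hα1 k))) →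
        γ₂ + a ^ 2 * γ₁ = -(1 / 2) * (a ^ 2 + 1) * (α + 1 / α) →
        γ₃ = 1 / 2 →
        ∀ τ ξ : ℝ, ∀ z w : ℂ, (z, w) ∈ BiasedAztec.surface a α → w ≠ 0 →
          z ≠ (a : ℂ) ^ 2 → z ≠ 1 / (a : ℂ) ^ 2 →
          ∀ s : ℂ → ℂ, BiasedAztec.IsSqrtBranch a α z w s →
            (∃ φ : ℂ → ℂ, BiasedAztec.IsActionBranch a d μ ν τ ξ s z φ) ∧
            ∀ φ : ℂ → ℂ, BiasedAztec.IsActionBranch a d μ ν τ ξ s z φ →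
              HasDerivAt φ
                ((d : ℂ) * (1 - (τ : ℂ)) * (a : ℂ) ^ 2 *
                    ((z * (γ₁ : ℂ) + (γ₂ : ℂ) + (γ₃ : ℂ) * w) / ((z - (a : ℂ) ^ 2) * z * w))
                  - (d : ℂ) * (τ : ℂ) *
                    (((γ₁ : ℂ) + (γ₂ : ℂ) * z + (γ₃ : ℂ) * z * w) /
                      ((z - 1 / (a : ℂ) ^ 2) * z * w))
                  + (d : ℂ) * (1 - (τ : ℂ) + (ξ : ℂ)) / z
                  - (d : ℂ) * (1 - (τ : ℂ)) / (z - (a : ℂ) ^ 2))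
                z := by
  have hdo : BiasedAztec.orbit a α ha0 hα0 hα1 d = BiasedAztec.orbit a α ha0 hα0 hα1 0 := by
    rw [← hord]; exact BiasedAztec.orbit_add_addOrderOf ha0 hα0 hα1
  have hMinus := BiasedAztec.isSurfaceEigenvalue_eigenvalueMinus ha0 hα0 hα1 hdo
  have hPlus := BiasedAztec.isSurfaceEigenvalue_eigenvaluePlus ha0 hα0 hα1 hdo
  refine ⟨⟨_, hMinus⟩, ⟨_, hPlus⟩, ?_⟩
  intro μ ν hμ hν γ₁ γ₂ γ₃ h₁ h₂ h₃ τ ξ z w hp hw hza hzb s hs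
  obtain rfl : s z = w := hs.value
  have hz : z ≠ 0 := hp.1
  have ha' := Complex.ofReal_ne_zero.2 ha0.ne'
  have hα' := Complex.ofReal_ne_zero.2 hα0.ne'
  have hd' : (d : ℂ) ≠ 0 := Nat.cast_ne_zero.2 hd.ne'
  have hza' : z - (a : ℂ) ^ 2 ≠ 0 := sub_ne_zero.2 hza
  have hzb' : 1 - (a : ℂ) ^ 2 * z ≠ 0 := fun h => hzb (by
    rw [eq_div_iff (pow_ne_zero 2 ha')]; linear_combination -h)
  have hμs := BiasedAztec.IsSurfaceEigenvalue.eventuallyEq ha0 hα0 hμ hMinus hs hz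
  have hνs := BiasedAztec.IsSurfaceEigenvalue.eventuallyEq ha0 hα0 hν hPlus hs hz
  obtain ⟨hF0, hF⟩ := BiasedAztec.hasDerivAt_eigenvalueMinus ha0 hα0 hα1 hdo hp hw hza hs
  have hprod := fun p hp => BiasedAztec.eigenvalueMinus_mul_eigenvaluePlus ha0 hα0 hα1 hdo (p := p) hp
  have hγ₁ : (d : ℝ) * γ₁ = -(a * α * ∑ k ∈ Finset.range d,
      1 / BiasedAztec.fnA a α (BiasedAztec.orbit a α ha0 hα0 hα1 k)) := by
    rw [h₁, BiasedAztec.sqrt_average_mul_sqrt_average ha0 hα0 (Finset.sum_nonneg fun j _ =>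
      (one_div_pos.2 ((BiasedAztec.isOvalPoint_orbit ha0 hα0 hα1 j).fnA_pos ha0 hα0)).le)
      (BiasedAztec.sum_fnA_orbit ha0 hα0 hα1 hdo)]
    have : (d : ℝ) ≠ 0 := Nat.cast_ne_zero.2 hd.ne'
    field_simp
  replace hγ₁ : (d : ℂ) * γ₁ = -(a * α * ((∑ k ∈ Finset.range d,
      1 / BiasedAztec.fnA a α (BiasedAztec.orbit a α ha0 hα0 hα1 k) : ℝ) : ℂ)) := by
    exact_mod_cast congrArg ((↑) : ℝ → ℂ) hγ₁
  replace h₂ : (γ₂ : ℂ) = -(1 / 2) * ((a : ℂ) ^ 2 + 1) * (α + 1 / α) - a ^ 2 * γ₁ := by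
    have := congrArg ((↑) : ℝ → ℂ) h₂
    push_cast at this
    linear_combination this
  have hll := BiasedAztec.lam_mul_lamConj hp
  have hl0 : BiasedAztec.lam a α (z, s z) ≠ 0 := by
    intro h
    rw [h, zero_mul] at hll
    exact mul_ne_zero hzb' (BiasedAztec.one_sub_div_ne_zero hz hza) hll.symm
  have hl : HasDerivAt (fun z => BiasedAztec.lam a α (z, s z))
      (1 / 2 * (4 * (a : ℂ) ^ 2 * (1 - 1 / z ^ 2) / (2 * s z))) z := by
    unfold BiasedAztec.lam
    exact ((hs.hasDerivAt hz hw).const_mul (1 / 2)).const_add _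
  have hG0 : BiasedAztec.eigenvaluePlus ha0 hα0 hα1 d (z, s z) ≠ 0 := by
    intro h
    have := hprod (z, s z) hp
    rw [h, mul_zero] at this
    exact pow_ne_zero d hl0 this.symm
  have hGs : (fun z => BiasedAztec.eigenvaluePlus ha0 hα0 hα1 d (z, s z)) =ᶠ[𝓝 z]
      fun z => BiasedAztec.lam a α (z, s z) ^ d /
        BiasedAztec.eigenvalueMinus ha0 hα0 hα1 d (z, s z) := by
    filter_upwards [hs.eventually_mem_surface hz, hF.continuousAt.eventually_ne
      hF0] with z h1 h2
    rw [eq_div_iff h2, mul_comm, hprod _ h1]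
  refine ⟨?_, ?_⟩
  · obtain ⟨lμ, hlμ⟩ := BiasedAztec.exists_isLogBranch (hs.continuousAt_comp hz hμ.continuousOn)
      (hμs.self_of_nhds.trans_ne hF0)
    obtain ⟨lν, hlν⟩ := BiasedAztec.exists_isLogBranch (hs.continuousAt_comp hz hν.continuousOn)
      (hνs.self_of_nhds.trans_ne hG0)
    obtain ⟨l₀, hl₀⟩ := BiasedAztec.exists_isLogBranch (f := fun z => z) (z₀ := z)
      (Filter.Eventually.of_forall fun z => continuousAt_id) hz
    obtain ⟨l₁, hl₁⟩ := BiasedAztec.exists_isLogBranch (f := fun z => z - (a : ℂ) ^ 2) (z₀ := z)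
      (Filter.Eventually.of_forall fun z => continuousAt_id.sub continuousAt_const) hza'
    exact ⟨_, lμ, lν, l₀, l₁, hlμ, hlν, hl₀, hl₁, Filter.Eventually.of_forall fun z => rfl⟩
  · rintro φ ⟨lμ, lν, l₀, l₁, hlμ, hlν, hl₀, hl₁, hφ⟩
    have dμ := hlμ.hasDerivAt (hF.congr_of_eventuallyEq hμs)
    have dG := (hl.fun_pow d).fun_div hF hF0
    have dν := hlν.hasDerivAt (dG.congr_of_eventuallyEq (hνs.trans hGs))
    have d₀ := hl₀.hasDerivAt (hasDerivAt_id z)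
    have d₁ := hl₁.hasDerivAt ((hasDerivAt_id z).sub_const _)
    have hφ' := ((((dμ.const_mul (1 - (τ : ℂ))).sub (dν.const_mul (τ : ℂ))).add
      (d₀.const_mul ((d : ℂ) * (1 - (τ : ℂ) + (ξ : ℂ))))).sub
      (d₁.const_mul ((d : ℂ) * (1 - (τ : ℂ))))).congr_of_eventuallyEq hφ
    refine hφ'.congr_deriv ?_
    have e1 : μ (z, s z) = BiasedAztec.eigenvalueMinus ha0 hα0 hα1 d (z, s z) := hμs.self_of_nhds
    have e2 : ν (z, s z) = BiasedAztec.lam a α (z, s z) ^ d /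
        BiasedAztec.eigenvalueMinus ha0 hα0 hα1 d (z, s z) := (hνs.trans hGs).self_of_nhds
    rw [e1, e2, h₃]
    generalize BiasedAztec.eigenvalueMinus ha0 hα0 hα1 d (z, s z) = F at *
    generalize ((∑ k ∈ Finset.range d,
      1 / BiasedAztec.fnA a α (BiasedAztec.orbit a α ha0 hα0 hα1 k) : ℝ) : ℂ) = S at *
    have hlc : BiasedAztec.lamConj a α (z, s z)
        = ((1 + (a : ℂ) ^ 2) * (α + 1 / α) - s z) / 2 := by
      rw [BiasedAztec.lamConj]; ring
    have hY : (-((a : ℂ) ^ 3 * α / z) * S - BiasedAztec.lamConj a α (z, s z) *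
          (d * ((a : ℂ) ^ 2 / (z * (z - (a : ℂ) ^ 2))))) / s z
        = d * (a : ℂ) ^ 2 * ((z * γ₁ + γ₂ + 1 / 2 * s z) / ((z - (a : ℂ) ^ 2) * z * s z)) := by
      have hS : -((a : ℂ) ^ 3 * α / z) * S = (a : ℂ) ^ 2 * (d * γ₁) / z := by rw [hγ₁]; ring
      rw [hS, hlc, h₂]
      generalize (α : ℂ) + 1 / α = b at *
      field_simp
      ring
    -- Replacing `1/λ` by `λ̄ / det P` puts `w` in the numerator, so the next identity is linear in
    -- `w` and does not need `w² = R(z)`.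
    have hlam : ∀ c : ℂ, c / BiasedAztec.lam a α (z, s z)
        = c * BiasedAztec.lamConj a α (z, s z) / ((1 - (a : ℂ) ^ 2 * z) * ((z - (a : ℂ) ^ 2) / z)) := by
      intro c
      have h0 := mul_ne_zero hzb' (div_ne_zero hza' hz)
      rw [one_sub_div hz] at hll
      rw [div_eq_div_iff hl0 h0, ← hll]
      ring
    -- The two fractions on the right add up to an expression free of `γ₁`: after eliminating `γ₂`
    -- its contributions are `a²γ₁` and `-a²γ₁`, up to a common factor.
    have hZ : d * (1 / 2 * (4 * (a : ℂ) ^ 2 * (1 - 1 / z ^ 2) / (2 * s z))) /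
          BiasedAztec.lam a α (z, s z)
        = d * (a : ℂ) ^ 2 * ((z * γ₁ + γ₂ + 1 / 2 * s z) / ((z - (a : ℂ) ^ 2) * z * s z))
          + d * ((γ₁ + γ₂ * z + 1 / 2 * z * s z) / ((z - 1 / (a : ℂ) ^ 2) * z * s z)) := by
      have hzb2 : z - 1 / (a : ℂ) ^ 2 = -(1 - (a : ℂ) ^ 2 * z) / (a : ℂ) ^ 2 := by
        field_simp
        ring
      rw [hlam, hlc, h₂, hzb2]
      generalize (α : ℂ) + 1 / α = b at *
      generalize hm : 1 - (a : ℂ) ^ 2 * z = m at *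
      generalize hn : z - (a : ℂ) ^ 2 = n at *
      field_simp
      rw [← hm, ← hn]
      ring
    have hquot : ∀ l' Y : ℂ, (d * BiasedAztec.lam a α (z, s z) ^ (d - 1) * l' * F
        - BiasedAztec.lam a α (z, s z) ^ d * (F * Y)) / F ^ 2 /
          (BiasedAztec.lam a α (z, s z) ^ d / F) = d * l' / BiasedAztec.lam a α (z, s z) - Y := by
      intro l' Y
      rw [← pow_sub_one_mul hd.ne' (BiasedAztec.lam a α (z, s z))]
      have := pow_ne_zero (d - 1) hl0
      field_simp
    rw [hquot, hY, hZ, mul_div_cancel_left₀ _ hF0]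
    push_cast
    ring
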